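/- There are an absolute constant $c>0$ and $M_0\in\mathbb N$ such that for all $n\in\mathbb N$ with $n\ge 2$, all $M\in\mathbb N$ with $M\ge M_0$ and all polytopes $P_M$ in $\mathbb R^n$ with at most $M$ facets, $$\Delta_s(B_2^n,P_M)\;\ge\; c\,\frac{\mathrm{vol}_{n-1}(\partial B_2^n)}{M^{\frac{2}{n-1}}}.$$ Here $B_2^n$ is the closed Euclidean unit ball of $\mathbb R^n$, $\Delta_s(K,L)=\mathrm{vol}_{n-1}(\partial(K\cup L))-\mathrm{vol}_{n-1}(\partial(K\cap L))$ is the symmetric surface area deviation, where $\partial$ is the topological boundary and $\mathrm{vol}_{n-1}$ the $(n-1)$-dimensional Hausdorff measure normalized to agree with Lebesgue measure on $\mathbb R^{n-1}$, a polytope is the convex hull of finitely many points, and its facets are its $(n-1)$-dimensional faces. No assumption is made on the position of $P_M$ relative to $B_2^n$; $c$ and $M_0$ depend neither on $n$ nor on $P_M$. -/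

import Mathlib

open MeasureTheory

/-- A polytope in `ℝⁿ`: the convex hull of finitely many points. -/
def IsPolytope {n : ℕ} (P : Set (EuclideanSpace ℝ (Fin n))) : Prop :=
  ∃ s : Set (EuclideanSpace ℝ (Fin n)), s.Finite ∧ P = convexHull ℝ s

/-- `F` is a facet of `P ⊆ ℝⁿ`: a nonempty face (the set of points of `P` at which some linear
functional attains its maximum over `P`) whose affine hull has dimension `n - 1`. -/
def IsFacet {n : ℕ} (P F : Set (EuclideanSpace ℝ (Fin n))) : Prop :=
  F.Nonempty ∧ IsExposed ℝ P F ∧ Module.finrank ℝ (vectorSpan ℝ F) + 1 = n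

/-- `vol_{n-1}(∂K)`: the `(n-1)`-dimensional Hausdorff measure, normalized to agree with Lebesgue
measure on `ℝⁿ⁻¹`, of the topological boundary of `K ⊆ ℝⁿ`. -/
noncomputable def surfaceArea {n : ℕ} (K : Set (EuclideanSpace ℝ (Fin n))) : ℝ :=
  (μHE[n - 1] : Measure (EuclideanSpace ℝ (Fin n))).real (frontier K)

/-- The symmetric surface area deviation
`Δ_s(K, L) = vol_{n-1}(∂(K ∪ L)) - vol_{n-1}(∂(K ∩ L))`. -/
noncomputable def surfaceDeviation {n : ℕ} (K L : Set (EuclideanSpace ℝ (Fin n))) : ℝ :=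
  surfaceArea (K ∪ L) - surfaceArea (K ∩ L)

/-- The closed Euclidean unit ball `B_2^n`. -/
def unitBall (n : ℕ) : Set (EuclideanSpace ℝ (Fin n)) :=
  Metric.closedBall 0 1

open Module Set Topology Filter
open scoped ENNReal NNReal RealInnerProductSpace

/-! ### Hausdorff measure of images: global and local Lipschitz bounds -/

section HausdorffLipschitz

variable {X Y Z : Type*}

/-! Write d = n - 1, S for the unit sphere, B for the open unit ball, and |·| for d-dimensional
area. Up to null sets the boundary of the union contains S \ P and ∂P \ B, and that of the
intersection lies in (S ∩ P) ∪ (∂P ∩ B). So the deviation is at least (|S \ P| - |∂P ∩ B|) + (|∂P \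
B| - |S ∩ P|), and both brackets are shown to be nonnegative with a quantitative gain.

Inside the ball, push each facet piece along its outer normal u onto S. The images avoid P, and they
are disjoint because each image point has its starting point as its nearest point in P. The push
enlarges area by 1/⟪u, z⟫ at the image z. Outside the ball, the radial projection of ∂P \ B covers S
∩ P and does not increase area.

Let h • u be the foot of the perpendicular from the origin to the facet's hyperplane. At distance at
least ρ from the foot, each comparison gains a proportion ρ²/8 of the facet's area
(`euclideanHausdorffMeasure_add_le_sphereAbove`, `euclideanHausdorffMeasure_radial_image_add_le`).
Points closer to the foot fill a disc of area at most ρ^d |S| per facet, hence at most M ρ^d |S| in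
all. Choose ρ with M ρ^d = 1/4. If |∂P| ≥ |S|/2, area at least |S|/4 is far from the feet and the
gain is at least ρ²|S|/32; otherwise the deviation is at least |S| - |∂P| ≥ |S|/2. Finally ρ² is at
least M^(-2/d)/16. No constant depends on the dimension, since every area is compared with |S|
itself. -/

theorem LipschitzOnWith.euclideanHausdorffMeasure_image_le [MetricSpace X] [MeasurableSpace X]
    [BorelSpace X] [MetricSpace Y] [MeasurableSpace Y] [BorelSpace Y] {K : ℝ≥0} {f : X → Y} {s : Set X}
    (h : LipschitzOnWith K f s) (d : ℕ) : μHE[d] (f '' s) ≤ (K : ℝ≥0∞) ^ d * μHE[d] s := by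
  have := h.hausdorffMeasure_image_le (d := (d : ℝ)) (by positivity)
  simp only [Measure.euclideanHausdorffMeasure_def, Measure.smul_apply,
    Measure.nnreal_smul_coe_apply]
  rw [ENNReal.rpow_natCast] at this
  calc _ ≤ _ := mul_le_mul_right this _
    _ = _ := mul_left_comm _ _ _

/-- The hypothesis makes `f` factor through `g` on `s` by a `K`-Lipschitz map, so two projections of
one set can be compared directly. -/
theorem euclideanHausdorffMeasure_image_le_image [MetricSpace Y] [MeasurableSpace Y]
    [BorelSpace Y] [MetricSpace Z] [MeasurableSpace Z] [BorelSpace Z] {K : ℝ} (hK : 0 ≤ K) {f : X → Y} {g : X → Z}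
    {s : Set X} (h : ∀ x ∈ s, ∀ y ∈ s, dist (f x) (f y) ≤ K * dist (g x) (g y)) (d : ℕ) :
    μHE[d] (f '' s) ≤ ENNReal.ofReal K ^ d * μHE[d] (g '' s) := by
  rcases s.eq_empty_or_nonempty with rfl | ⟨x₀, -⟩
  · simp
  have : Nonempty X := ⟨x₀⟩
  have hinv : ∀ y ∈ g '' s, Function.invFunOn g s y ∈ s ∧ g (Function.invFunOn g s y) = y :=
    fun y hy ↦ ⟨Function.invFunOn_mem hy, Function.invFunOn_eq hy⟩
  have hlip : LipschitzOnWith K.toNNReal (f ∘ Function.invFunOn g s) (g '' s) := by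
    refine LipschitzOnWith.of_dist_le_mul fun x hx y hy ↦ ?_
    have := h _ (hinv x hx).1 _ (hinv y hy).1
    rwa [(hinv x hx).2, (hinv y hy).2, ← Real.coe_toNNReal K hK] at this
  have himg : f '' s ⊆ (f ∘ Function.invFunOn g s) '' (g '' s) := by
    rintro _ ⟨x, hx, rfl⟩
    refine ⟨g x, mem_image_of_mem g hx, ?_⟩
    have hx' := hinv _ (mem_image_of_mem g hx)
    have := h _ hx'.1 _ hx
    rw [hx'.2, dist_self, mul_zero] at this
    exact dist_le_zero.1 this
  exact (measure_mono himg).trans (hlip.euclideanHausdorffMeasure_image_le d)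

/-- A bound for the measure of images that holds locally holds globally. -/
theorem measure_image_le_of_locally [TopologicalSpace X] [SecondCountableTopology X]
    [MeasurableSpace X] [BorelSpace X] [MeasurableSpace Y] (μ : Measure X) (ν : Measure Y)
    {f : X → Y} {k : ℝ≥0∞} {T : Set X}
    (h : ∀ x ∈ T, ∃ U ∈ 𝓝 x, ∀ W ⊆ T ∩ U, ν (f '' W) ≤ k * μ W) : ν (f '' T) ≤ k * μ T := by
  choose! U hU hW using h
  obtain ⟨t, htT, htc, hcov⟩ := TopologicalSpace.countable_cover_nhdsWithin
    (s := T) (f := fun x ↦ interior (U x))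
    (fun x hx ↦ mem_nhdsWithin_of_mem_nhds (interior_mem_nhds.2 (hU x hx)))
  rcases T.eq_empty_or_nonempty with rfl | hne
  · simp
  have htne : t.Nonempty := by
    obtain ⟨x, hx⟩ := hne
    obtain ⟨y, hy, -⟩ := mem_iUnion₂.1 (hcov hx)
    exact ⟨y, hy⟩
  obtain ⟨e, he⟩ := htc.exists_eq_range htne
  set D := disjointed fun n ↦ interior (U (e n)) with hD
  have hDm : ∀ n, MeasurableSet (D n) := MeasurableSet.disjointed fun n ↦
    isOpen_interior.measurableSet
  have hDsub : ∀ n, D n ⊆ U (e n) := fun n ↦ (disjointed_subset _ n).trans interior_subset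
  have hDcov : T ⊆ ⋃ n, D n := by
    rw [hD, iUnion_disjointed]
    intro x hx
    obtain ⟨y, hy, hxy⟩ := mem_iUnion₂.1 (hcov hx)
    rw [he] at hy
    obtain ⟨n, rfl⟩ := hy
    exact mem_iUnion.2 ⟨n, hxy⟩
  calc ν (f '' T) ≤ ν (⋃ n, f '' (T ∩ D n)) := by
        rw [← image_iUnion, ← inter_iUnion, inter_eq_left.2 hDcov]
    _ ≤ ∑' n, ν (f '' (T ∩ D n)) := measure_iUnion_le _
    _ ≤ ∑' n, k * μ (T ∩ D n) := ENNReal.tsum_le_tsum fun n ↦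
        hW (e n) (htT (he ▸ mem_range_self n)) _ (inter_subset_inter_right _ (hDsub n))
    -- `T` need not be measurable; additivity is used for `μ.restrict T` along the measurable sets
    -- `D n`.
    _ = k * ∑' n, μ.restrict T (D n) := by
        rw [ENNReal.tsum_mul_left]
        simp_rw [Measure.restrict_apply (hDm _), inter_comm]
    _ = k * μ.restrict T (⋃ n, D n) := by
        rw [measure_iUnion (disjoint_disjointed _) hDm]
    _ ≤ k * μ T := by
        refine mul_le_mul_right ?_ _
        exact (measure_mono (subset_univ _)).trans (Measure.restrict_apply_univ T).le

end HausdorffLipschitz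

/-! ### Orthogonal and radial projection -/

section Projection

variable {V : Type*} [NormedAddCommGroup V] [InnerProductSpace ℝ V]

/-- The orthogonal projection onto the orthogonal complement of the unit vector `z`. -/
def perp (z x : V) : V := x - ⟪z, x⟫ • z

/-- The radial projection onto the unit sphere. -/
noncomputable def radial (x : V) : V := ‖x‖⁻¹ • x

theorem inner_perp {z : V} (hz : ‖z‖ = 1) (x : V) : ⟪z, perp z x⟫ = 0 := by
  simp [perp, inner_sub_right, inner_smul_right, hz]

theorem perp_sub (z x y : V) : perp z x - perp z y = perp z (x - y) := by
  simp only [perp, inner_sub_right, sub_smul]; abel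

theorem norm_perp_sq {z : V} (hz : ‖z‖ = 1) (x : V) : ‖perp z x‖ ^ 2 = ‖x‖ ^ 2 - ⟪z, x⟫ ^ 2 := by
  rw [perp, norm_sub_sq_real, inner_smul_right, norm_smul, hz, real_inner_comm, Real.norm_eq_abs,
    mul_one, sq_abs]
  ring

theorem norm_perp_le {z : V} (hz : ‖z‖ = 1) (x : V) : ‖perp z x‖ ≤ ‖x‖ := by
  refine le_of_sq_le_sq ?_ (norm_nonneg _)
  rw [norm_perp_sq hz]
  nlinarith [sq_nonneg ⟪z, x⟫]

theorem lipschitzWith_perp {z : V} (hz : ‖z‖ = 1) : LipschitzWith 1 (perp z) :=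
  LipschitzWith.of_dist_le_mul fun x y ↦ by
    simpa [dist_eq_norm, perp_sub] using norm_perp_le hz (x - y)

theorem norm_radial {x : V} (hx : x ≠ 0) : ‖radial x‖ = 1 := by
  simp [radial, norm_smul, hx]

/-- Both sides equal 2 - 2 cos θ, with θ the angle between `x` and `y`. The exact form is needed: it
shows that radial differences do not contribute to the distance after projection. -/
theorem norm_radial_sub_sq {x y : V} (hx : x ≠ 0) (hy : y ≠ 0) :
    ‖radial x - radial y‖ ^ 2 = (‖x - y‖ ^ 2 - (‖x‖ - ‖y‖) ^ 2) / (‖x‖ * ‖y‖) := by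
  have hx' := norm_ne_zero_iff.2 hx
  have hy' := norm_ne_zero_iff.2 hy
  rw [norm_sub_sq_real, norm_radial hx, norm_radial hy, norm_sub_sq_real]
  simp only [radial, inner_smul_left, inner_smul_right, RCLike.conj_to_real]
  field_simp
  ring

theorem dist_radial_le {R : ℝ} (hR : 0 < R) {x y : V} (hx : R ≤ ‖x‖) (hy : R ≤ ‖y‖) :
    dist (radial x) (radial y) ≤ R⁻¹ * dist x y := by
  have hx0 : x ≠ 0 := norm_pos_iff.1 (hR.trans_le hx)
  have hy0 : y ≠ 0 := norm_pos_iff.1 (hR.trans_le hy)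
  rw [dist_eq_norm, dist_eq_norm]
  refine le_of_sq_le_sq ?_ (by positivity)
  rw [norm_radial_sub_sq hx0 hy0, mul_pow, inv_pow, ← div_eq_inv_mul]
  have : R ^ 2 ≤ ‖x‖ * ‖y‖ := by rw [sq]; gcongr
  gcongr
  nlinarith [sq_nonneg (‖x‖ - ‖y‖)]

variable [FiniteDimensional ℝ V]

/-- The Gram operator f*f is the identity minus the rank-one map x ↦ ⟪z, x⟫ • (projection of `z` to
uᗮ). Its determinant is 1 - ‖perp u z‖² = ⟪u, z⟫². -/
theorem normDet_perp {u z : V} (hu : ‖u‖ = 1) (hz : ‖z‖ = 1) (f : (ℝ ∙ u)ᗮ →ₗ[ℝ] V)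
    (hf : ∀ x, f x = perp z x) : f.normDet = |⟪u, z⟫| := by
  have hadj : LinearMap.adjoint f ∘ₗ f =
      LinearMap.transvection (-((innerSL ℝ z).toLinearMap ∘ₗ (ℝ ∙ u)ᗮ.subtype))
        ((ℝ ∙ u)ᗮ.orthogonalProjectionOnto z) := by
    refine LinearMap.ext fun x ↦ ext_inner_right ℝ fun y ↦ ?_
    rw [LinearMap.comp_apply, LinearMap.adjoint_inner_left, hf, hf, LinearMap.transvection.apply]
    simp [perp, inner_sub_left, inner_sub_right, inner_smul_left, inner_smul_right, inner_add_left,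
      hz, real_inner_comm]
    ring
  have hdet := f.normDet_sq
  rw [hadj, LinearMap.transvection.det] at hdet
  have hproj : (((ℝ ∙ u)ᗮ.orthogonalProjectionOnto z : (ℝ ∙ u)ᗮ) : V) = perp u z := by
    rw [← Submodule.starProjection_apply, Submodule.starProjection_orthogonal_val,
      Submodule.starProjection_unit_singleton ℝ hu]
    rfl
  simp only [LinearMap.neg_apply, LinearMap.comp_apply, Submodule.subtype_apply, hproj] at hdet
  have h2 : f.normDet ^ 2 = ⟪u, z⟫ ^ 2 := by
    have : f.normDet ^ 2 = 1 + -⟪z, perp u z⟫ := hdet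
    rw [this, perp, inner_sub_right, inner_smul_right, real_inner_self_eq_norm_sq, hz,
      real_inner_comm]
    ring
  rw [← abs_of_nonneg f.normDet_nonneg]
  exact (sq_eq_sq_iff_abs_eq_abs _ _).1 h2

end Projection

/-- Strict slack in an area factor absorbs the distortion of linearizing on a small ball; this
supplies the radius for `measure_image_le_of_locally`. -/
theorem exists_pos_mul_one_add_pow_lt {c k : ℝ} (a : ℝ) (d : ℕ) (h : c < k) :
    ∃ δ : ℝ, 0 < δ ∧ c * (1 + a * δ) ^ d < k := by
  have hcont : ContinuousAt (fun δ : ℝ ↦ c * (1 + a * δ) ^ d) 0 := by fun_prop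
  have hev : ∀ᶠ δ in 𝓝 (0 : ℝ), c * (1 + a * δ) ^ d < k :=
    hcont.eventually_lt continuousAt_const (by simpa using h)
  obtain ⟨δ, h1, h2⟩ :=
    ((hev.filter_mono nhdsWithin_le_nhds).and (self_mem_nhdsWithin (s := Ioi (0 : ℝ)))).exists
  exact ⟨δ, h2, h1⟩

/-! ### Area factors between hyperplanes and the sphere -/

section Hyperplane

variable {V : Type*} [NormedAddCommGroup V] [InnerProductSpace ℝ V]

/-- The parametrization of the hyperplane `{x | ⟪u, x⟫ = h}` by `uᗮ`. -/
def hyperplaneParam (u : V) (h : ℝ) (w : (ℝ ∙ u)ᗮ) : V := w + h • u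

theorem isometry_hyperplaneParam (u : V) (h : ℝ) : Isometry (hyperplaneParam u h) :=
  Isometry.of_dist_eq fun x y ↦ by simp [hyperplaneParam, Subtype.dist_eq]

theorem image_hyperplaneParam_preimage {u : V} (hu : ‖u‖ = 1) {h : ℝ} {W : Set V}
    (hW : ∀ x ∈ W, ⟪u, x⟫ = h) : hyperplaneParam u h '' (hyperplaneParam u h ⁻¹' W) = W := by
  refine image_preimage_eq_of_subset fun x hx ↦ ⟨⟨perp u x, ?_⟩, ?_⟩
  · exact Submodule.mem_orthogonal_singleton_iff_inner_right.2 (inner_perp hu x)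
  · simp [hyperplaneParam, perp, hW x hx]

variable [FiniteDimensional ℝ V] [MeasurableSpace V] [BorelSpace V] {d : ℕ}
  [hd : Fact (finrank ℝ V = d + 1)]

theorem euclideanHausdorffMeasure_orthogonal {u : V} (hu : ‖u‖ = 1) :
    (μHE[d] : Measure (ℝ ∙ u)ᗮ) = volume := by
  have hfr : finrank ℝ (ℝ ∙ u)ᗮ = d :=
    Submodule.finrank_orthogonal_span_singleton (norm_ne_zero_iff.1 (hu ▸ one_ne_zero))
  have := InnerProductSpace.euclideanHausdorffMeasure_eq_volume (V := (ℝ ∙ u)ᗮ)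
  rwa [hfr] at this

theorem euclideanHausdorffMeasure_hyperplane {u : V} (hu : ‖u‖ = 1) {h : ℝ} {W : Set V}
    (hW : ∀ x ∈ W, ⟪u, x⟫ = h) : μHE[d] W = volume (hyperplaneParam u h ⁻¹' W) := by
  conv_lhs => rw [← image_hyperplaneParam_preimage hu hW]
  rw [(isometry_hyperplaneParam u h).euclideanHausdorffMeasure_image,
    euclideanHausdorffMeasure_orthogonal hu]

/-- Orthogonal projection between hyperplanes scales areas by the cosine of their angle. -/
theorem euclideanHausdorffMeasure_perp_image {u z : V} (hu : ‖u‖ = 1) (hz : ‖z‖ = 1) {h : ℝ}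
    {W : Set V} (hW : ∀ x ∈ W, ⟪u, x⟫ = h) :
    μHE[d] (perp z '' W) = ENNReal.ofReal |⟪u, z⟫| * μHE[d] W := by
  let f : (ℝ ∙ u)ᗮ →ₗ[ℝ] V := (LinearMap.id - (innerₛₗ ℝ z).smulRight z) ∘ₗ (ℝ ∙ u)ᗮ.subtype
  have hf : ∀ x, f x = perp z x := fun x ↦ by simp [f, perp]
  have himg : perp z '' W =
      (fun v ↦ v + h • perp z u) '' (f '' (hyperplaneParam u h ⁻¹' W)) := by
    conv_lhs => rw [← image_hyperplaneParam_preimage hu hW]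
    rw [image_image, image_image]
    refine image_congr fun w _ ↦ ?_
    simp only [hyperplaneParam, hf, perp, inner_add_right, inner_smul_right, add_smul, smul_sub,
      mul_smul]
    abel
  have hiso : Isometry fun v : V ↦ v + h • perp z u := isometry_add_right _
  have hfr : finrank ℝ (ℝ ∙ u)ᗮ = d :=
    Submodule.finrank_orthogonal_span_singleton (norm_ne_zero_iff.1 (hu ▸ one_ne_zero))
  have := f.euclideanHausdorffMeasure_image_eq_normDet_mul_volume (hyperplaneParam u h ⁻¹' W)
  rw [hfr, normDet_perp hu hz f hf] at this
  rw [himg, hiso.euclideanHausdorffMeasure_image, this, euclideanHausdorffMeasure_hyperplane hu hW]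

/-- Projecting a spherical set to a hyperplane with which it makes a definite angle. -/
theorem euclideanHausdorffMeasure_perp_image_sphere_le {u : V} (hu : ‖u‖ = 1) {k : ℝ} {G : Set V}
    (hG : ∀ z ∈ G, ‖z‖ = 1 ∧ 0 < ⟪u, z⟫ ∧ ⟪u, z⟫ < k) :
    μHE[d] (perp u '' G) ≤ ENNReal.ofReal k * μHE[d] G := by
  refine measure_image_le_of_locally _ _ fun z₀ hz₀ ↦ ?_
  obtain ⟨hz, hc, hck⟩ := hG z₀ hz₀
  set c := ⟪u, z₀⟫ with hcdef
  obtain ⟨δ, hδ, hδk⟩ := exists_pos_mul_one_add_pow_lt c⁻¹ d hck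
  rw [inv_mul_eq_div] at hδk
  refine ⟨Metric.ball z₀ δ, Metric.ball_mem_nhds _ hδ, fun W hW ↦ ?_⟩
  -- Oblique projection along `u` onto the tangent space z₀ᗮ. It leaves `perp u` unchanged, and near
  -- `z₀` it is almost 1-Lipschitz on the sphere: x - y is orthogonal to x + y, hence nearly
  -- orthogonal to `z₀`.
  let o : V → V := fun x ↦ x - (⟪z₀, x⟫ / c) • u
  have ho : ∀ x, ⟪z₀, o x⟫ = 0 := fun x ↦ by
    simp only [o, inner_sub_right, inner_smul_right]
    rw [real_inner_comm u z₀, ← hcdef]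
    field_simp
    ring
  have hpo : perp u '' W = perp u '' (o '' W) := by
    rw [image_image]
    refine image_congr fun x _ ↦ ?_
    simp only [o, perp, inner_sub_right, inner_smul_right, real_inner_self_eq_norm_sq, hu, sub_smul]
    simp
  have hlip : μHE[d] (o '' W) ≤ ENNReal.ofReal (1 + δ / c) ^ d * μHE[d] (id '' W) := by
    refine euclideanHausdorffMeasure_image_le_image (by positivity) (fun x hx y hy ↦ ?_) d
    have hxs := (hG x (hW hx).1).1
    have hys := (hG y (hW hy).1).1
    have h1 : ⟪z₀, x - y⟫ = ⟪z₀ - (1 / 2 : ℝ) • (x + y), x - y⟫ := by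
      have : ⟪x + y, x - y⟫ = 0 := by
        rw [real_inner_add_sub_eq_zero_iff, hxs, hys]
      rw [inner_sub_left, inner_smul_left, this]; simp
    have h2 : ‖z₀ - (1 / 2 : ℝ) • (x + y)‖ ≤ δ := by
      have : z₀ - (1 / 2 : ℝ) • (x + y) = (1 / 2 : ℝ) • (z₀ - x) + (1 / 2 : ℝ) • (z₀ - y) := by
        module
      rw [this]
      refine (norm_add_le _ _).trans ?_
      have hx' : ‖z₀ - x‖ < δ := mem_ball_iff_norm'.1 (hW hx).2
      have hy' : ‖z₀ - y‖ < δ := mem_ball_iff_norm'.1 (hW hy).2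
      rw [norm_smul, norm_smul]
      norm_num
      linarith
    have h3 : |⟪z₀, x - y⟫| ≤ δ * ‖x - y‖ := by
      rw [h1]
      exact (abs_real_inner_le_norm _ _).trans (by gcongr)
    have h4 : o x - o y = (x - y) - (⟪z₀, x - y⟫ / c) • u := by
      simp only [o, inner_sub_right]
      module
    simp only [id, dist_eq_norm]
    rw [h4]
    refine (norm_sub_le _ _).trans ?_
    rw [norm_smul, hu, mul_one, Real.norm_eq_abs, abs_div, abs_of_pos hc]
    have := div_le_div_of_nonneg_right h3 hc.le
    calc _ ≤ ‖x - y‖ + δ * ‖x - y‖ / c := by gcongr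
      _ = _ := by ring
  rw [image_id] at hlip
  rw [hpo, euclideanHausdorffMeasure_perp_image hz hu (h := 0) (by rintro _ ⟨x, -, rfl⟩; exact ho x),
    real_inner_comm, abs_of_pos hc]
  calc _ ≤ ENNReal.ofReal c * (ENNReal.ofReal (1 + δ / c) ^ d * μHE[d] W) := by gcongr
    _ = ENNReal.ofReal (c * (1 + δ / c) ^ d) * μHE[d] W := by
      rw [ENNReal.ofReal_mul hc.le, ENNReal.ofReal_pow (by positivity), mul_assoc]
    _ ≤ _ := by gcongr

/-- Radially projecting a part of a hyperplane that is seen from the origin at a definite angle. -/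
theorem euclideanHausdorffMeasure_radial_image_le_of_angle {u : V} (hu : ‖u‖ = 1) {h k : ℝ}
    (hh : h ≠ 0) {X : Set V} (hX : ∀ x ∈ X, ⟪u, x⟫ = h ∧ 1 ≤ ‖x‖ ∧ |h| < k * ‖x‖) :
    μHE[d] (radial '' X) ≤ ENNReal.ofReal k * μHE[d] X := by
  refine measure_image_le_of_locally _ _ fun x₀ hx₀ ↦ ?_
  obtain ⟨hux, hx1, hxk⟩ := hX x₀ hx₀
  have hr : 0 < ‖x₀‖ := by linarith
  have hx0 : x₀ ≠ 0 := norm_pos_iff.1 hr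
  set z := radial x₀ with hzdef
  have hz : ‖z‖ = 1 := norm_radial hx0
  have hrz : ‖x₀‖ • z = x₀ := by simp [hzdef, radial, smul_smul, hr.ne']
  have huz : ⟪u, z⟫ = h / ‖x₀‖ := by
    rw [hzdef, radial, inner_smul_right, hux]; field_simp
  set m := |⟪u, z⟫| with hm
  have hm0 : 0 < m := by rw [hm, huz, abs_pos]; positivity
  have hmk : m < k := by
    rw [hm, huz, abs_div, abs_of_pos hr, div_lt_iff₀ hr]; exact hxk
  obtain ⟨δ, hδ, hδk⟩ := exists_pos_mul_one_add_pow_lt (4 / m ^ 2) d hmk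
  rw [div_mul_eq_mul_div] at hδk
  refine ⟨Metric.ball x₀ δ, Metric.ball_mem_nhds _ hδ, fun W hW ↦ ?_⟩
  -- To first order at `x₀` the radial projection is `perp z` divided by ‖x₀‖ ≥ 1, so locally it is
  -- compared with `perp z`, whose area factor on the hyperplane is `m`.
  have hlip : μHE[d] (radial '' W) ≤
      ENNReal.ofReal (1 + 4 * δ / m ^ 2) ^ d * μHE[d] (perp z '' W) := by
    refine euclideanHausdorffMeasure_image_le_image (by positivity) (fun x hx y hy ↦ ?_) d
    obtain ⟨hxu, hx1, -⟩ := hX x (hW hx).1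
    obtain ⟨hyu, hy1, -⟩ := hX y (hW hy).1
    have hx0 : x ≠ 0 := norm_pos_iff.1 (by linarith)
    have hy0 : y ≠ 0 := norm_pos_iff.1 (by linarith)
    have hx' : ‖x - x₀‖ < δ := mem_ball_iff_norm.1 (hW hx).2
    have hy' : ‖y - x₀‖ < δ := mem_ball_iff_norm.1 (hW hy).2
    rw [dist_eq_norm, dist_eq_norm, perp_sub]
    set e := x - y with he
    have hue : ⟪u, e⟫ = 0 := by rw [he, inner_sub_right, hxu, hyu, sub_self]
    -- the direction of `e` is not too close to `z`
    have hze : ⟪z, e⟫ ^ 2 ≤ (1 - m ^ 2) * ‖e‖ ^ 2 := by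
      have h1 : ⟪z, e⟫ = ⟪perp u z, e⟫ := by
        rw [perp, inner_sub_left, inner_smul_left, hue]; simp
      have h2 : ‖perp u z‖ ^ 2 = 1 - m ^ 2 := by rw [norm_perp_sq hu, hz, hm, sq_abs]; norm_num
      rw [h1, ← h2, ← mul_pow, ← sq_abs]
      gcongr
      exact abs_real_inner_le_norm _ _
    have hq : m ^ 2 * ‖e‖ ^ 2 ≤ ‖perp z e‖ ^ 2 := by rw [norm_perp_sq hz]; linarith
    have hs : 0 < ‖x‖ + ‖y‖ := by linarith
    -- (‖x‖ + ‖y‖)(‖x‖ - ‖y‖) = ⟪x + y, e⟫, and x + y is close to (‖x‖ + ‖y‖) • z. The resulting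
    -- error is absorbed through `hq`, which is where the angle `m` > 0 enters.
    have hdiff : |⟪z, e⟫ - (‖x‖ - ‖y‖)| ≤ 2 * δ * ‖e‖ := by
      have h1 : ⟪x + y, e⟫ = (‖x‖ + ‖y‖) * (‖x‖ - ‖y‖) := by
        rw [he, inner_add_left, inner_sub_right, inner_sub_right, real_inner_self_eq_norm_sq,
          real_inner_self_eq_norm_sq, real_inner_comm x y]
        ring
      have h2 : (‖x‖ + ‖y‖) * (⟪z, e⟫ - (‖x‖ - ‖y‖)) = ⟪(‖x‖ + ‖y‖) • z - (x + y), e⟫ := by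
        rw [inner_sub_left, h1, inner_smul_left]; simp; ring
      have h3 : ‖(‖x‖ + ‖y‖) • z - (x + y)‖ ≤ 4 * δ := by
        have : (‖x‖ + ‖y‖) • z - (x + y) =
            (‖x‖ - ‖x₀‖) • z + (‖y‖ - ‖x₀‖) • z - (x - x₀) - (y - x₀) := by
          have : (‖x‖ - ‖x₀‖) • z + (‖y‖ - ‖x₀‖) • z - (x - x₀) - (y - x₀) =
            (‖x‖ + ‖y‖) • z - (2 : ℝ) • (‖x₀‖ • z) - (x + y) + (2 : ℝ) • x₀ := by module
          rw [this, hrz]; abel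
        rw [this]
        have a1 := (abs_norm_sub_norm_le x x₀).trans hx'.le
        have a2 := (abs_norm_sub_norm_le y x₀).trans hy'.le
        have b1 : ‖(‖x‖ - ‖x₀‖) • z‖ ≤ δ := by simpa [norm_smul, hz] using a1
        have b2 : ‖(‖y‖ - ‖x₀‖) • z‖ ≤ δ := by simpa [norm_smul, hz] using a2
        have c1 := norm_sub_le ((‖x‖ - ‖x₀‖) • z + (‖y‖ - ‖x₀‖) • z - (x - x₀)) (y - x₀)
        have c2 := norm_sub_le ((‖x‖ - ‖x₀‖) • z + (‖y‖ - ‖x₀‖) • z) (x - x₀)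
        have c3 := norm_add_le ((‖x‖ - ‖x₀‖) • z) ((‖y‖ - ‖x₀‖) • z)
        linarith
      have h4 : (‖x‖ + ‖y‖) * |⟪z, e⟫ - (‖x‖ - ‖y‖)| ≤ 4 * δ * ‖e‖ := by
        have h6 := congrArg abs h2
        rw [abs_mul, abs_of_pos hs] at h6
        rw [h6]
        exact (abs_real_inner_le_norm _ _).trans (by gcongr)
      have h5 : 2 * |⟪z, e⟫ - (‖x‖ - ‖y‖)| ≤ (‖x‖ + ‖y‖) * |⟪z, e⟫ - (‖x‖ - ‖y‖)| := by
        gcongr; linarith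
      linarith
    have hsq : ⟪z, e⟫ ^ 2 ≤ (‖x‖ - ‖y‖) ^ 2 + 4 * δ * ‖e‖ ^ 2 := by
      have h1 : |⟪z, e⟫ + (‖x‖ - ‖y‖)| ≤ 2 * ‖e‖ := by
        have h2 := abs_real_inner_le_norm z e
        rw [hz, one_mul] at h2
        linarith [abs_add_le ⟪z, e⟫ (‖x‖ - ‖y‖), abs_norm_sub_norm_le x y]
      have h3 : (⟪z, e⟫ - (‖x‖ - ‖y‖)) * (⟪z, e⟫ + (‖x‖ - ‖y‖)) ≤
          (2 * δ * ‖e‖) * (2 * ‖e‖) := by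
        refine (le_abs_self _).trans ?_
        rw [abs_mul]
        gcongr
      linarith
    have hrad : ‖radial x - radial y‖ ^ 2 ≤ ‖e‖ ^ 2 - (‖x‖ - ‖y‖) ^ 2 := by
      rw [norm_radial_sub_sq hx0 hy0]
      refine div_le_self ?_ (one_le_mul_of_one_le_of_one_le hx1 hy1)
      have := abs_norm_sub_norm_le x y
      have := sq_le_sq.2 (this.trans (le_abs_self _))
      linarith
    have ht : 0 ≤ 4 * δ / m ^ 2 := by positivity
    refine le_of_sq_le_sq ?_ (by positivity)
    calc ‖radial x - radial y‖ ^ 2 ≤ ‖perp z e‖ ^ 2 + 4 * δ * ‖e‖ ^ 2 := by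
          rw [norm_perp_sq hz]; linarith
      _ = ‖perp z e‖ ^ 2 + 4 * δ / m ^ 2 * (m ^ 2 * ‖e‖ ^ 2) := by field_simp
      _ ≤ ‖perp z e‖ ^ 2 + 4 * δ / m ^ 2 * ‖perp z e‖ ^ 2 := by gcongr
      _ = (1 + 4 * δ / m ^ 2) * ‖perp z e‖ ^ 2 := by ring
      _ ≤ (1 + 4 * δ / m ^ 2) ^ 2 * ‖perp z e‖ ^ 2 := by gcongr; nlinarith
      _ = _ := by ring
  rw [euclideanHausdorffMeasure_perp_image hu hz fun x hx ↦ (hX x (hW hx).1).1] at hlip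
  calc _ ≤ _ := hlip
    _ = ENNReal.ofReal (m * (1 + 4 * δ / m ^ 2) ^ d) * μHE[d] W := by
      rw [ENNReal.ofReal_mul hm0.le, ENNReal.ofReal_pow (by positivity)]; ring
    _ ≤ _ := by gcongr

omit [FiniteDimensional ℝ V] hd in
theorem euclideanHausdorffMeasure_radial_image_le {R : ℝ} (hR : 0 < R) {X : Set V}
    (hX : ∀ x ∈ X, R ≤ ‖x‖) :
    μHE[d] (radial '' X) ≤ ENNReal.ofReal R⁻¹ ^ d * μHE[d] X := by
  have := euclideanHausdorffMeasure_image_le_image (f := radial) (g := id) (s := X) (K := R⁻¹)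
    (by positivity) (fun x hx y hy ↦ dist_radial_le hR (hX x hx) (hX y hy)) d
  rwa [image_id] at this

theorem euclideanHausdorffMeasure_sphere_inter_hyperplane (hd0 : d ≠ 0) {u : V} (hu : ‖u‖ = 1)
    (h : ℝ) : μHE[d] {x : V | ‖x‖ = 1 ∧ ⟪u, x⟫ = h} = 0 := by
  have hfr : finrank ℝ (ℝ ∙ u)ᗮ = d :=
    Submodule.finrank_orthogonal_span_singleton (norm_ne_zero_iff.1 (hu ▸ one_ne_zero))
  have : Nontrivial (ℝ ∙ u)ᗮ := nontrivial_of_finrank_pos (R := ℝ) (by omega)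
  rw [euclideanHausdorffMeasure_hyperplane hu fun x hx ↦ hx.2]
  refine measure_mono_null (t := Metric.sphere 0 √(1 - h ^ 2)) ?_ (Measure.addHaar_sphere _ _ _)
  intro w hw
  have hw' := Submodule.mem_orthogonal_singleton_iff_inner_right.1 w.2
  have h1 : ‖(w : V) + h • u‖ ^ 2 = ‖w‖ ^ 2 + h ^ 2 := by
    rw [norm_add_sq_real, inner_smul_right, real_inner_comm, hw', norm_smul, hu]; simp
  have h2 : ‖(w : V) + h • u‖ = 1 := hw.1
  rw [h2] at h1
  rw [mem_sphere_zero_iff_norm, show 1 - h ^ 2 = ‖w‖ ^ 2 by linarith, Real.sqrt_sq (norm_nonneg _)]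

/-- Each cap ⟪z, x⟫ > 1/2 lies in the 1-Lipschitz radial image of a bounded piece of the tangent
hyperplane at `z`; compactness finishes. -/
theorem euclideanHausdorffMeasure_sphere_lt_top : μHE[d] (Metric.sphere (0 : V) 1) < ∞ := by
  refine (isCompact_sphere _ _).measure_lt_top_of_nhdsWithin fun z hz ↦ ?_
  have hz : ‖z‖ = 1 := by simpa using hz
  have hopen : IsOpen {x : V | 1 / 2 < ⟪z, x⟫} := isOpen_lt (by fun_prop) (by fun_prop)
  have hmem : z ∈ {x : V | 1 / 2 < ⟪z, x⟫} := by
    rw [mem_ofPred_eq, real_inner_self_eq_norm_sq, hz]; norm_num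
  refine ⟨_, Filter.inter_mem (mem_nhdsWithin_of_mem_nhds (hopen.mem_nhds hmem))
    self_mem_nhdsWithin, ?_⟩
  set Y : Set V := {y | ⟪z, y⟫ = 1 ∧ ‖y‖ ≤ 2} with hY
  have hY1 : ∀ y ∈ Y, 1 ≤ ‖y‖ := fun y hy ↦ by
    have := real_inner_le_norm z y
    rwa [hy.1, hz, one_mul] at this
  have hYtop : μHE[d] Y < ∞ := by
    rw [euclideanHausdorffMeasure_hyperplane hz fun y hy ↦ hy.1]
    refine (measure_mono (t := Metric.closedBall 0 3) fun w hw ↦ ?_).trans_lt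
      measure_closedBall_lt_top
    have h1 : ‖(w : V) + (1 : ℝ) • z‖ ≤ 2 := hw.2
    have h2 := norm_sub_le ((w : V) + (1 : ℝ) • z) z
    rw [one_smul, add_sub_cancel_right, hz] at h2
    rw [one_smul] at h1
    rw [mem_closedBall_zero_iff]
    change ‖(w : V)‖ ≤ 3
    linarith
  have himg := euclideanHausdorffMeasure_radial_image_le (d := d) one_pos hY1
  rw [inv_one, ENNReal.ofReal_one, one_pow, one_mul] at himg
  refine (measure_mono ?_).trans_lt (himg.trans_lt hYtop)
  rintro x ⟨hzx, hx⟩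
  have hzx : 1 / 2 < ⟪z, x⟫ := hzx
  have hx : ‖x‖ = 1 := by simpa using hx
  have hpos : 0 < ⟪z, x⟫ := by linarith
  have hn : ‖⟪z, x⟫⁻¹ • x‖ = ⟪z, x⟫⁻¹ := by
    rw [norm_smul, hx, mul_one, Real.norm_of_nonneg (by positivity)]
  refine ⟨⟪z, x⟫⁻¹ • x, ⟨?_, ?_⟩, ?_⟩
  · rw [inner_smul_right]; field_simp
  · rw [hn, inv_le_comm₀ hpos two_pos]; linarith
  · rw [radial, hn, inv_inv, smul_inv_smul₀ hpos.ne']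

omit [FiniteDimensional ℝ V] hd in
/-- The part of a hyperplane close to its point nearest to the origin has small area. -/
theorem euclideanHausdorffMeasure_disc_le {u : V} (hu : ‖u‖ = 1) (h : ℝ) {ρ : ℝ} (hρ : 0 < ρ) :
    μHE[d] {x : V | ⟪u, x⟫ = h ∧ ‖x‖ ^ 2 - h ^ 2 < ρ ^ 2} ≤
      ENNReal.ofReal ρ ^ d * μHE[d] (Metric.sphere (0 : V) 1) := by
  -- The disc lies in the image of the sphere under a ρ-Lipschitz map, so its area is compared with
  -- the sphere's without computing either.
  have := euclideanHausdorffMeasure_image_le_image (f := fun z ↦ ρ • perp u z + h • u) (g := id)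
    (s := Metric.sphere (0 : V) 1) hρ.le (fun x _ y _ ↦ by
      rw [dist_add_right, dist_smul₀, Real.norm_of_nonneg hρ.le]
      gcongr
      simpa using (lipschitzWith_perp hu).dist_le_mul x y) d
  rw [image_id] at this
  refine (measure_mono ?_).trans this
  rintro x ⟨hx, hxρ⟩
  have hux : ⟪u, perp u x⟫ = 0 := inner_perp hu x
  have hn : ‖perp u x‖ ^ 2 < ρ ^ 2 := by rw [norm_perp_sq hu, hx]; exact hxρ
  have hn' : ‖ρ⁻¹ • perp u x‖ ^ 2 ≤ 1 := by
    rw [norm_smul, mul_pow, norm_inv, Real.norm_of_nonneg hρ.le, inv_pow,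
      inv_mul_le_iff₀ (by positivity)]
    linarith
  refine ⟨ρ⁻¹ • perp u x + √(1 - ‖ρ⁻¹ • perp u x‖ ^ 2) • u, ?_, ?_⟩
  · have : ‖ρ⁻¹ • perp u x + √(1 - ‖ρ⁻¹ • perp u x‖ ^ 2) • u‖ ^ 2 = 1 := by
      rw [norm_add_sq_real, inner_smul_left, inner_smul_right, real_inner_comm, hux,
        norm_smul √_, hu, Real.norm_of_nonneg (Real.sqrt_nonneg _), mul_one,
        Real.sq_sqrt (by linarith)]
      simp
    rw [mem_sphere_zero_iff_norm]
    exact (pow_eq_one_iff_of_nonneg (norm_nonneg _) two_ne_zero).1 this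
  · simp only
    have : perp u (ρ⁻¹ • perp u x + √(1 - ‖ρ⁻¹ • perp u x‖ ^ 2) • u) = ρ⁻¹ • perp u x := by
      rw [perp, inner_add_right, inner_smul_right, inner_smul_right, hux,
        real_inner_self_eq_norm_sq, hu]
      simp
    rw [this, smul_inv_smul₀ hρ.ne', perp, hx]
    simp

end Hyperplane

/-! ### Faces and supporting hyperplanes -/

section Faces

variable {V : Type*} [NormedAddCommGroup V] [InnerProductSpace ℝ V]

/-- A face of a convex hull is the convex hull of the generators it contains. -/
theorem convexHull_inter_hyperplane {s : Set V} {u : V} {h : ℝ} (hs : ∀ y ∈ s, ⟪u, y⟫ ≤ h) :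
    convexHull ℝ s ∩ {x | ⟪u, x⟫ = h} = convexHull ℝ (s ∩ {x | ⟪u, x⟫ = h}) := by
  refine Subset.antisymm ?_ (subset_inter (convexHull_mono inter_subset_left) ?_)
  · have hsub : convexHull ℝ s ⊆
        {x | ⟪u, x⟫ ≤ h ∧ (⟪u, x⟫ = h → x ∈ convexHull ℝ (s ∩ {x | ⟪u, x⟫ = h}))} := by
      refine convexHull_min (fun y hy ↦ ⟨hs y hy, fun e ↦ subset_convexHull ℝ _ ⟨hy, e⟩⟩) ?_
      refine convex_iff_forall_pos.2 fun x hx y hy a b ha hb hab ↦ ?_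
      have hi : ⟪u, a • x + b • y⟫ = a * ⟪u, x⟫ + b * ⟪u, y⟫ := by
        rw [inner_add_right, inner_smul_right, inner_smul_right]
      have h1 := mul_le_mul_of_nonneg_left hx.1 ha.le
      have h2 := mul_le_mul_of_nonneg_left hy.1 hb.le
      have h3 : a * h + b * h = h := by rw [← add_mul, hab, one_mul]
      refine ⟨by rw [hi]; linarith, fun e ↦ ?_⟩
      rw [hi] at e
      exact convex_convexHull ℝ _ (hx.2 (mul_left_cancel₀ ha.ne' (by linarith)))
        (hy.2 (mul_left_cancel₀ hb.ne' (by linarith))) ha.le hb.le hab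
    exact fun x hx ↦ (hsub hx.1).2 hx.2
  · exact convexHull_min inter_subset_right (convex_hyperplane (innerₛₗ ℝ u).isLinear h)

theorem finite_faces {s : Set V} (hs : s.Finite) :
    {F | ∃ (u : V) (h : ℝ), (∀ y ∈ convexHull ℝ s, ⟪u, y⟫ ≤ h) ∧
      F = convexHull ℝ s ∩ {x | ⟪u, x⟫ = h}}.Finite := by
  refine (hs.finite_subsets.image (convexHull ℝ)).subset ?_
  rintro F ⟨u, h, hle, rfl⟩
  exact ⟨_, inter_subset_left,
    (convexHull_inter_hyperplane fun y hy ↦ hle y (subset_convexHull ℝ s hy)).symm⟩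

variable [FiniteDimensional ℝ V]

/-- Hahn–Banach when `P` has interior. Otherwise `P` lies in a proper affine subspace, and any
normal to it supports `P` everywhere; flat polytopes are thus included. -/
theorem exists_unit_normal {P : Set V} (hP : Convex ℝ P) {x : V} (hx : x ∈ P)
    (hxi : x ∉ interior P) : ∃ u : V, ‖u‖ = 1 ∧ ∀ y ∈ P, ⟪u, y⟫ ≤ ⟪u, x⟫ := by
  obtain ⟨v, hv0, hv⟩ : ∃ v : V, v ≠ 0 ∧ ∀ y ∈ P, ⟪v, y⟫ ≤ ⟪v, x⟫ := by
    by_cases hne : (interior P).Nonempty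
    · obtain ⟨f, hf0, hf⟩ := geometric_hahn_banach_of_nonempty_interior_point hP hxi hne
      refine ⟨(InnerProductSpace.toDual ℝ V).symm f, by simpa using hf0, fun y hy ↦ ?_⟩
      simpa using hf y hy
    · have hspan : vectorSpan ℝ P ≠ ⊤ := by
        rw [hP.interior_nonempty_iff_affineSpan_eq_top] at hne
        rwa [Ne, ← AffineSubspace.affineSpan_eq_top_iff_vectorSpan_eq_top_of_nonempty ℝ V V ⟨x, hx⟩]
      have hbot : (vectorSpan ℝ P)ᗮ ≠ ⊥ := by rwa [Ne, Submodule.orthogonal_eq_bot_iff]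
      obtain ⟨v, hv, hv0⟩ := Submodule.exists_mem_ne_zero_of_ne_bot hbot
      refine ⟨v, hv0, fun y hy ↦ ?_⟩
      have := (Submodule.mem_orthogonal' _ _).1 hv _ (vsub_mem_vectorSpan ℝ hy hx)
      rw [vsub_eq_sub, inner_sub_right] at this
      linarith
  refine ⟨‖v‖⁻¹ • v, norm_smul_inv_norm hv0, fun y hy ↦ ?_⟩
  simp only [inner_smul_left, RCLike.conj_to_real]
  exact mul_le_mul_of_nonneg_left (hv y hy) (by positivity)

theorem finrank_vectorSpan_le_of_subset_hyperplane {d : ℕ} [Fact (finrank ℝ V = d + 1)] {F : Set V}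
    {u : V} (hu : ‖u‖ = 1) {h : ℝ} (hF : ∀ x ∈ F, ⟪u, x⟫ = h) :
    finrank ℝ (vectorSpan ℝ F) ≤ d := by
  rw [← Submodule.finrank_orthogonal_span_singleton (𝕜 := ℝ) (n := d)
    (norm_ne_zero_iff.1 (hu ▸ one_ne_zero) : u ≠ 0)]
  refine Submodule.finrank_mono ?_
  rw [vectorSpan_def, Submodule.span_le]
  rintro _ ⟨x, hx, y, hy, rfl⟩
  refine Submodule.mem_orthogonal_singleton_iff_inner_right.2 ?_
  change ⟪u, x - y⟫ = 0
  rw [inner_sub_right, hF x hx, hF y hy, sub_self]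

theorem euclideanHausdorffMeasure_eq_zero_of_finrank_lt [MeasurableSpace V] [BorelSpace V] {d : ℕ}
    {F : Set V} (hF : Convex ℝ F) (h : finrank ℝ (vectorSpan ℝ F) < d) : μHE[d] F = 0 := by
  rcases F.eq_empty_or_nonempty with rfl | hne
  · simp
  have h1 : dimH F < ((d : ℝ≥0) : ℝ≥0∞) := by
    rw [Real.Convex.dimH_eq_finrank_vectorSpan hF hne]
    exact_mod_cast h
  have h2 := hausdorffMeasure_of_dimH_lt h1
  rw [NNReal.coe_natCast] at h2
  rw [Measure.euclideanHausdorffMeasure_def, Measure.smul_apply, h2, smul_zero]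

end Faces

/-! ### Facets cover the boundary almost everywhere -/

section Polytope

/-- Up to a null set, the boundary of a polytope is covered by its facets. -/
theorem IsPolytope.exists_facet_normals {d M : ℕ} {P : Set (EuclideanSpace ℝ (Fin (d + 1)))}
    (hP : IsPolytope P) (hM : {F | IsFacet P F}.encard ≤ M) :
    ∃ (m : ℕ) (u : Fin m → EuclideanSpace ℝ (Fin (d + 1))) (h : Fin m → ℝ), m ≤ M ∧
      (∀ i, ‖u i‖ = 1) ∧ (∀ i, ∀ y ∈ P, ⟪u i, y⟫ ≤ h i) ∧
      μHE[d] (frontier P \ ⋃ i, P ∩ {x | ⟪u i, x⟫ = h i}) = 0 := by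
  have : Fact (finrank ℝ (EuclideanSpace ℝ (Fin (d + 1))) = d + 1) := ⟨by simp⟩
  obtain ⟨s, hs, rfl⟩ := hP
  set P := convexHull ℝ s with hPdef
  have hPc : Convex ℝ P := convex_convexHull ℝ s
  set 𝓐 : Set (Set (EuclideanSpace ℝ (Fin (d + 1)))) :=
    {F | ∃ u h, ‖u‖ = 1 ∧ (∀ y ∈ P, ⟪u, y⟫ ≤ h) ∧ F = P ∩ {x | ⟪u, x⟫ = h}} with h𝓐
  have h𝓐fin : 𝓐.Finite := by
    refine (finite_faces hs).subset ?_
    rintro F ⟨u, h, -, hle, hF⟩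
    exact ⟨u, h, hle, hF⟩
  -- Facets are indexed as sets, not by their normals: a flat polytope is a facet of itself with two
  -- opposite normals, and must be counted once.
  set 𝓕 := 𝓐 ∩ {F | IsFacet P F} with h𝓕
  have h𝓕fin : 𝓕.Finite := h𝓐fin.subset inter_subset_left
  have hcard : 𝓕.ncard ≤ M := by
    have : 𝓕.encard ≤ M := (encard_le_encard inter_subset_right).trans hM
    rw [← h𝓕fin.cast_ncard_eq] at this
    exact_mod_cast this
  have := h𝓕fin.to_subtype
  let e : Fin 𝓕.ncard ≃ 𝓕 := (Finite.equivFinOfCardEq (Nat.card_coe_set_eq 𝓕)).symm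
  choose u h hu hle hF using fun i ↦ (e i).2.1
  refine ⟨𝓕.ncard, u, h, hcard, hu, hle, ?_⟩
  -- A face in a supporting hyperplane that is not a facet has dimension below `d`, and there are
  -- finitely many.
  have hnull : μHE[d] (⋃ F ∈ 𝓐 \ {F | IsFacet P F}, F) = 0 := by
    refine (measure_biUnion_null_iff (h𝓐fin.subset sdiff_subset).countable).2 ?_
    rintro F ⟨⟨u, h, hu, hle, hF⟩, hnot⟩
    have hFh : ∀ x ∈ F, ⟪u, x⟫ = h := fun x hx ↦ (hF ▸ hx).2
    have hFc : Convex ℝ F := by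
      rw [hF]; exact hPc.inter (convex_hyperplane (innerₛₗ ℝ u).isLinear h)
    rcases F.eq_empty_or_nonempty with rfl | hne
    · simp
    refine euclideanHausdorffMeasure_eq_zero_of_finrank_lt hFc
      ((finrank_vectorSpan_le_of_subset_hyperplane (d := d) hu hFh).lt_of_ne fun heq ↦ hnot ?_)
    refine ⟨hne, fun _ ↦ ⟨innerSL ℝ u, ?_⟩, by rw [heq]⟩
    obtain ⟨x₀, hx₀⟩ := hne
    ext x
    simp only [innerSL_apply_apply, mem_ofPred_eq]
    constructor
    · intro hx
      refine ⟨(hF ▸ hx).1, fun y hy ↦ ?_⟩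
      rw [hFh x hx]
      exact hle y hy
    · rintro ⟨hx, hmax⟩
      rw [hF]
      exact ⟨hx, le_antisymm (hle x hx) (hFh x₀ hx₀ ▸ hmax x₀ (hF ▸ hx₀).1)⟩
  refine measure_mono_null (fun x hx ↦ ?_) hnull
  have hclosed : IsClosed P := (hs.isCompact_convexHull (𝕜 := ℝ)).isClosed
  have hxP : x ∈ P := hclosed.frontier_subset hx.1
  obtain ⟨v, hv, hvle⟩ := exists_unit_normal hPc hxP hx.1.2
  have hmem : P ∩ {y | ⟪v, y⟫ = ⟪v, x⟫} ∈ 𝓐 := ⟨v, _, hv, hvle, rfl⟩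
  refine mem_iUnion₂.2 ⟨_, ⟨hmem, fun hfac ↦ hx.2 ?_⟩, ⟨hxP, rfl⟩⟩
  obtain ⟨i, hi⟩ := e.surjective ⟨_, hmem, hfac⟩
  refine mem_iUnion.2 ⟨i, ?_⟩
  rw [← hF i, hi]
  exact ⟨hxP, rfl⟩

end Polytope

/-! ### Area gain over a single facet -/

section FacetPieces

variable {V : Type*} [NormedAddCommGroup V] [InnerProductSpace ℝ V]

/-- The points of the unit sphere that lie above `X` in direction `u`, where `X` is a subset of the
hyperplane `{x | ⟪u, x⟫ = h}`. -/
def sphereAbove (u : V) (h : ℝ) (X : Set V) : Set V :=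
  {z | ‖z‖ = 1 ∧ h < ⟪u, z⟫ ∧ z - (⟪u, z⟫ - h) • u ∈ X}

/-- The points at distance at least `ρ` from the foot `h • u` of the perpendicular from the origin
to the hyperplane `{x | ⟪u, x⟫ = h}`. -/
def farFromFoot (h ρ : ℝ) : Set V := {x | ρ ^ 2 ≤ ‖x‖ ^ 2 - h ^ 2}

omit [InnerProductSpace ℝ V] in
theorem isClosed_farFromFoot (h ρ : ℝ) : IsClosed (farFromFoot h ρ : Set V) :=
  isClosed_le (by fun_prop) (by fun_prop)

theorem sphereAbove_union (u : V) (h : ℝ) (X Y : Set V) :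
    sphereAbove u h (X ∪ Y) = sphereAbove u h X ∪ sphereAbove u h Y := by
  ext z; simp only [sphereAbove, mem_union, mem_ofPred_eq]; tauto

theorem subset_image_sphereAbove {u : V} (hu : ‖u‖ = 1) {h : ℝ} {X : Set V}
    (hX : ∀ x ∈ X, ⟪u, x⟫ = h ∧ ‖x‖ < 1) :
    X ⊆ (fun w ↦ w + h • u) '' (perp u '' sphereAbove u h X) := by
  intro x hx
  obtain ⟨hux, hx1⟩ := hX x hx
  have hsq : ‖x‖ ^ 2 < 1 := by nlinarith [norm_nonneg x]
  set c := √(1 - ‖x‖ ^ 2 + h ^ 2) with hc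
  have hc2 : c ^ 2 = 1 - ‖x‖ ^ 2 + h ^ 2 := Real.sq_sqrt (by nlinarith [sq_nonneg h])
  have hc0 : 0 ≤ c := Real.sqrt_nonneg _
  have hhc : h < c := by nlinarith
  set z := x + (c - h) • u with hz
  have huz : ⟪u, z⟫ = c := by
    rw [hz, inner_add_right, inner_smul_right, hux, real_inner_self_eq_norm_sq, hu]; ring
  have hzx : z - (⟪u, z⟫ - h) • u = x := by rw [huz, hz, add_sub_cancel_right]
  refine ⟨perp u z, ⟨z, ⟨?_, by rwa [huz], by rwa [hzx]⟩, rfl⟩, ?_⟩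
  · have : ‖z‖ ^ 2 = 1 := by
      rw [hz, norm_add_sq_real, inner_smul_right, real_inner_comm, hux, norm_smul, hu, mul_one,
        Real.norm_eq_abs, sq_abs]
      linarith
    exact (pow_eq_one_iff_of_nonneg (norm_nonneg _) two_ne_zero).1 this
  · simp only [perp]
    rw [sub_add, ← sub_smul, hzx]

theorem sphereAbove_subset_sdiff {P : Set V} {u : V} {h : ℝ}
    (hP : ∀ y ∈ P, ⟪u, y⟫ ≤ h) (X : Set V) : sphereAbove u h X ⊆ Metric.sphere 0 1 \ P :=
  fun z hz ↦ ⟨by simpa using hz.1, fun hzP ↦ (hP z hzP).not_gt hz.2.1⟩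

/-- The cylinders erected over different facets are disjoint. -/
theorem disjoint_sphereAbove {P : Set V} {u₁ u₂ : V} (hu₁ : ‖u₁‖ = 1) (hu₂ : ‖u₂‖ = 1)
    {h₁ h₂ : ℝ} (hP₁ : ∀ y ∈ P, ⟪u₁, y⟫ ≤ h₁) (hP₂ : ∀ y ∈ P, ⟪u₂, y⟫ ≤ h₂) {X₁ X₂ : Set V}
    (hX₁ : X₁ ⊆ P) (hX₂ : X₂ ⊆ P) (hX : Disjoint X₁ X₂) :
    Disjoint (sphereAbove u₁ h₁ X₁) (sphereAbove u₂ h₂ X₂) := by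
  refine Set.disjoint_left.2 fun z ⟨_, hz₁, hm₁⟩ ⟨_, hz₂, hm₂⟩ ↦ ?_
  set s₁ := ⟪u₁, z⟫ - h₁ with hs₁
  set s₂ := ⟪u₂, z⟫ - h₂ with hs₂
  set y₁ := z - s₁ • u₁ with hy₁
  set y₂ := z - s₂ • u₂ with hy₂
  have e₁ : ⟪u₁, y₁⟫ = h₁ := by
    rw [hy₁, inner_sub_right, inner_smul_right, real_inner_self_eq_norm_sq, hu₁]; linarith
  have e₂ : ⟪u₂, y₂⟫ = h₂ := by
    rw [hy₂, inner_sub_right, inner_smul_right, real_inner_self_eq_norm_sq, hu₂]; linarith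
  have i₁ : s₁ * ⟪u₁, y₂ - y₁⟫ ≤ 0 := by
    rw [inner_sub_right, e₁]
    exact mul_nonpos_of_nonneg_of_nonpos (by linarith) (by linarith [hP₁ _ (hX₂ hm₂)])
  have i₂ : s₂ * ⟪u₂, y₁ - y₂⟫ ≤ 0 := by
    rw [inner_sub_right, e₂]
    exact mul_nonpos_of_nonneg_of_nonpos (by linarith) (by linarith [hP₂ _ (hX₁ hm₁)])
  -- Uniqueness of the nearest point of `P` to `z`: both terms on the right are nonpositive, so `y₁`
  -- and `y₂` coincide.
  have hsum : ‖y₂ - y₁‖ ^ 2 = s₁ * ⟪u₁, y₂ - y₁⟫ + s₂ * ⟪u₂, y₁ - y₂⟫ := by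
    have hd : y₂ - y₁ = s₁ • u₁ - s₂ • u₂ := by rw [hy₁, hy₂]; abel
    have hin : ⟪y₂ - y₁, y₂ - y₁⟫ = ⟪s₁ • u₁ - s₂ • u₂, y₂ - y₁⟫ := by rw [← hd]
    rw [← neg_sub y₂ y₁, inner_neg_right, ← real_inner_self_eq_norm_sq, hin, inner_sub_left,
      real_inner_smul_left, real_inner_smul_left]
    ring
  have : y₂ = y₁ := by
    have : ‖y₂ - y₁‖ ^ 2 = 0 := le_antisymm (by linarith) (sq_nonneg _)
    exact sub_eq_zero.1 (norm_eq_zero.1 (pow_eq_zero_iff two_ne_zero |>.1 this))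
  exact Set.disjoint_left.1 hX hm₁ (this ▸ hm₂)

/-- Every point of the sphere in `P` is the radial projection of a boundary point outside. -/
theorem sphere_inter_subset_radial_image {P : Set V} (hP : IsCompact P) :
    Metric.sphere 0 1 ∩ P ⊆ radial '' (frontier P \ Metric.ball 0 1) := by
  rintro z ⟨hz, hzP⟩
  have hz : ‖z‖ = 1 := by simpa using hz
  have hcont : Continuous fun t : ℝ ↦ t • z := by fun_prop
  obtain ⟨R, hR⟩ := hP.isBounded.exists_norm_le
  have hT : IsCompact (Icc 1 (max 1 R) ∩ (fun t : ℝ ↦ t • z) ⁻¹' P) :=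
    isCompact_Icc.inter_right (hP.isClosed.preimage hcont)
  obtain ⟨t, ⟨⟨ht1, -⟩, htP⟩, htmax⟩ := hT.exists_isGreatest ⟨1, ⟨le_rfl, le_max_left _ _⟩, by simpa⟩
  have htP : t • z ∈ P := htP
  have ht0 : 0 < t := by linarith
  have hnt : ‖t • z‖ = t := by rw [norm_smul, hz, mul_one, Real.norm_of_nonneg ht0.le]
  refine ⟨t • z, ⟨⟨subset_closure htP, fun hint ↦ ?_⟩, ?_⟩, ?_⟩
  · have hev : ∀ᶠ s in 𝓝 t, s • z ∈ P :=
      (hcont.tendsto t).eventually (mem_interior_iff_mem_nhds.1 hint)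
    obtain ⟨s, hsP, hst⟩ :=
      ((hev.filter_mono nhdsWithin_le_nhds).and (self_mem_nhdsWithin (s := Ioi t))).exists
    have hst : t < s := hst
    have hs0 : 0 ≤ s := by linarith
    have hsR : s ≤ R := by
      have := hR _ hsP
      rwa [norm_smul, hz, mul_one, Real.norm_of_nonneg hs0] at this
    exact (htmax ⟨⟨by linarith, hsR.trans (le_max_right _ _)⟩, hsP⟩).not_gt hst
  · simpa [hnt] using ht1
  · rw [radial, hnt, inv_smul_smul₀ ht0.ne']

theorem inter_hyperplane_subset_frontier {P : Set V} {u : V} (hu : ‖u‖ = 1)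
    {h : ℝ} (hle : ∀ y ∈ P, ⟪u, y⟫ ≤ h) : P ∩ {x | ⟪u, x⟫ = h} ⊆ frontier P := by
  rintro x ⟨hx, hxh⟩
  have hxh : ⟪u, x⟫ = h := hxh
  refine ⟨subset_closure hx, fun hint ↦ ?_⟩
  have hcont : Continuous fun t : ℝ ↦ x + t • u := by fun_prop
  have hev : ∀ᶠ t in 𝓝 (0 : ℝ), x + t • u ∈ P :=
    (hcont.tendsto 0).eventually (by simpa using mem_interior_iff_mem_nhds.1 hint)
  obtain ⟨t, htP, ht⟩ :=
    ((hev.filter_mono nhdsWithin_le_nhds).and (self_mem_nhdsWithin (s := Ioi (0 : ℝ)))).exists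
  have ht : 0 < t := ht
  have := hle _ htP
  rw [inner_add_right, inner_smul_right, real_inner_self_eq_norm_sq, hu, hxh] at this
  linarith

variable [FiniteDimensional ℝ V] [MeasurableSpace V] [BorelSpace V]

omit [FiniteDimensional ℝ V] in
theorem measurableSet_sphereAbove (u : V) (h : ℝ) {X : Set V} (hX : MeasurableSet X) :
    MeasurableSet (sphereAbove u h X) := by
  have h1 : IsClosed {z : V | ‖z‖ = 1} := isClosed_eq (by fun_prop) (by fun_prop)
  have h2 : IsOpen {z : V | h < ⟪u, z⟫} := isOpen_lt (by fun_prop) (by fun_prop)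
  have h3 : Continuous fun z : V ↦ z - (⟪u, z⟫ - h) • u := by fun_prop
  exact h1.measurableSet.inter (h2.measurableSet.inter (h3.measurable hX))

variable {d : ℕ} [hd : Fact (finrank ℝ V = d + 1)]

omit [FiniteDimensional ℝ V] hd in
theorem euclideanHausdorffMeasure_le_perp_image {u : V} (hu : ‖u‖ = 1) {h : ℝ} {X : Set V}
    (hX : ∀ x ∈ X, ⟪u, x⟫ = h ∧ ‖x‖ < 1) :
    μHE[d] X ≤ μHE[d] (perp u '' sphereAbove u h X) := by
  have hiso : Isometry fun w : V ↦ w + h • u := isometry_add_right _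
  rw [← hiso.euclideanHausdorffMeasure_image (perp u '' _)]
  exact measure_mono (subset_image_sphereAbove hu hX)

/-- A point `z` above a far point `x` has ⟪u, z⟫² = 1 - (‖x‖² - h²) ≤ 1 - ρ² < (1 - ρ²/8)², and (1 +
t)(1 - t) ≤ 1. -/
theorem one_add_mul_euclideanHausdorffMeasure_le {u : V} (hu : ‖u‖ = 1) {h ρ : ℝ} (hρ : 0 < ρ)
    (hρ1 : ρ ≤ 1) {X : Set V} (hX : ∀ x ∈ X, ⟪u, x⟫ = h ∧ ‖x‖ < 1) (hfar : X ⊆ farFromFoot h ρ) :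
    μHE[d] X + ENNReal.ofReal (ρ ^ 2 / 8) * μHE[d] X ≤ μHE[d] (sphereAbove u h X) := by
  have hρ2 : 0 < ρ ^ 2 := by positivity
  have hρ3 : ρ ^ 2 ≤ 1 := pow_le_one₀ hρ.le hρ1
  have hk : 0 ≤ 1 - ρ ^ 2 / 8 := by linarith
  have hle : μHE[d] X ≤ ENNReal.ofReal (1 - ρ ^ 2 / 8) * μHE[d] (sphereAbove u h X) := by
    refine (euclideanHausdorffMeasure_le_perp_image hu hX).trans
      (euclideanHausdorffMeasure_perp_image_sphere_le hu fun z hz ↦ ?_)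
    obtain ⟨hz1, hzh, hzX⟩ := hz
    set c := ⟪u, z⟫ with hc
    have hn : ‖z - (c - h) • u‖ ^ 2 = 1 - c ^ 2 + h ^ 2 := by
      rw [norm_sub_sq_real, inner_smul_right, real_inner_comm, ← hc, norm_smul, hu, mul_one,
        Real.norm_eq_abs, sq_abs, hz1]
      ring
    have h1 := (hX _ hzX).2
    have h2 : ρ ^ 2 ≤ ‖z - (c - h) • u‖ ^ 2 - h ^ 2 := hfar hzX
    have h3 : ‖z - (c - h) • u‖ ^ 2 < 1 := by nlinarith [norm_nonneg (z - (c - h) • u)]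
    rw [hn] at h2 h3
    refine ⟨hz1, by nlinarith, lt_of_pow_lt_pow_left₀ 2 hk ?_⟩
    nlinarith
  calc μHE[d] X + ENNReal.ofReal (ρ ^ 2 / 8) * μHE[d] X
      = ENNReal.ofReal (1 + ρ ^ 2 / 8) * μHE[d] X := by
        rw [ENNReal.ofReal_add one_pos.le (by positivity), ENNReal.ofReal_one, add_mul, one_mul]
    _ ≤ ENNReal.ofReal (1 + ρ ^ 2 / 8) *
        (ENNReal.ofReal (1 - ρ ^ 2 / 8) * μHE[d] (sphereAbove u h X)) := by gcongr
    _ = ENNReal.ofReal ((1 + ρ ^ 2 / 8) * (1 - ρ ^ 2 / 8)) * μHE[d] (sphereAbove u h X) := by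
        rw [ENNReal.ofReal_mul (by positivity), mul_assoc]
    _ ≤ 1 * μHE[d] (sphereAbove u h X) := by
        gcongr
        rw [ENNReal.ofReal_le_one]
        nlinarith
    _ = _ := one_mul _

/-- The gain in area from a piece of a facet inside the ball to the sphere above it. -/
theorem euclideanHausdorffMeasure_add_le_sphereAbove {u : V} (hu : ‖u‖ = 1) {h ρ : ℝ} (hρ : 0 < ρ)
    (hρ1 : ρ ≤ 1) {D : Set V} (hDm : MeasurableSet D) (hD : ∀ x ∈ D, ⟪u, x⟫ = h ∧ ‖x‖ < 1) :
    μHE[d] D + ENNReal.ofReal (ρ ^ 2 / 8) * μHE[d] (D ∩ farFromFoot h ρ) ≤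
      μHE[d] (sphereAbove u h D) := by
  have hAm : MeasurableSet (farFromFoot h ρ : Set V) := (isClosed_farFromFoot h ρ).measurableSet
  have hfar := one_add_mul_euclideanHausdorffMeasure_le (d := d) hu hρ hρ1
    (X := D ∩ farFromFoot h ρ) (fun x hx ↦ hD x hx.1) inter_subset_right
  have hnear : μHE[d] (D \ farFromFoot h ρ) ≤ μHE[d] (sphereAbove u h (D \ farFromFoot h ρ)) := by
    refine (euclideanHausdorffMeasure_le_perp_image hu fun x hx ↦ hD x hx.1).trans ?_
    have := (lipschitzWith_perp hu).lipschitzOnWith.euclideanHausdorffMeasure_image_le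
      (s := sphereAbove u h (D \ farFromFoot h ρ)) d
    simpa using this
  have hsplit : sphereAbove u h D =
      sphereAbove u h (D ∩ farFromFoot h ρ) ∪ sphereAbove u h (D \ farFromFoot h ρ) := by
    rw [← sphereAbove_union, inter_union_sdiff]
  rw [hsplit, measure_union (Set.disjoint_left.2 fun z hz hz' ↦ hz'.2.2.2 hz.2.2.2)
    (measurableSet_sphereAbove u h (hDm.diff hAm)), ← measure_inter_add_sdiff D hAm, add_right_comm]
  gcongr

theorem euclideanHausdorffMeasure_radial_image_le_of_far (hd0 : d ≠ 0) {u : V} (hu : ‖u‖ = 1)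
    {h ρ : ℝ} (hρ : 0 < ρ) (hρ1 : ρ ≤ 1) {X : Set V}
    (hX : ∀ x ∈ X, ⟪u, x⟫ = h ∧ 1 ≤ ‖x‖) (hfar : X ⊆ farFromFoot h ρ) :
    μHE[d] (radial '' X) ≤ ENNReal.ofReal (1 - ρ ^ 2 / 8) * μHE[d] X := by
  have hρ2 : 0 < ρ ^ 2 := by positivity
  have hρ3 : ρ ^ 2 ≤ 1 := pow_le_one₀ hρ.le hρ1
  rcases eq_or_ne h 0 with rfl | hh
  · refine (measure_mono_null ?_ (euclideanHausdorffMeasure_sphere_inter_hyperplane hd0 hu 0)).trans_le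
      zero_le
    rintro _ ⟨x, hx, rfl⟩
    refine ⟨norm_radial (norm_pos_iff.1 (by linarith [(hX x hx).2])), ?_⟩
    rw [radial, inner_smul_right, (hX x hx).1, mul_zero]
  -- Beyond radius `R` the Lipschitz constant R⁻¹ ≤ 1 - ρ²/8 suffices. Below it ‖x‖² < 2, so ρ² ≤
  -- ‖x‖² - h² forces a definite angle: h²/‖x‖² < 1 - ρ²/2.
  set R := 1 + ρ ^ 2 / 4 with hR
  have hR0 : 0 < R := by positivity
  have hfar' : μHE[d] (radial '' (X \ Metric.ball 0 R)) ≤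
      ENNReal.ofReal (1 - ρ ^ 2 / 8) * μHE[d] (X \ Metric.ball 0 R) := by
    refine (euclideanHausdorffMeasure_radial_image_le hR0 fun x hx ↦ by simpa using hx.2).trans ?_
    have h1 : ENNReal.ofReal R⁻¹ ≤ ENNReal.ofReal (1 - ρ ^ 2 / 8) := by
      refine ENNReal.ofReal_le_ofReal ((inv_le_iff_one_le_mul₀ hR0).2 ?_)
      nlinarith
    have h2 : ENNReal.ofReal R⁻¹ ≤ 1 := by
      rw [ENNReal.ofReal_le_one]
      exact inv_le_one_of_one_le₀ (by linarith)
    refine mul_le_mul_left ((pow_le_of_le_one zero_le h2 hd0).trans h1) _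
  have hnear : μHE[d] (radial '' (X ∩ Metric.ball 0 R)) ≤
      ENNReal.ofReal (1 - ρ ^ 2 / 8) * μHE[d] (X ∩ Metric.ball 0 R) := by
    refine euclideanHausdorffMeasure_radial_image_le_of_angle hu hh fun x hx ↦ ?_
    obtain ⟨hxu, hx1⟩ := hX x hx.1
    refine ⟨hxu, hx1, ?_⟩
    have hxR : ‖x‖ < R := by simpa using hx.2
    have hxf : ρ ^ 2 ≤ ‖x‖ ^ 2 - h ^ 2 := hfar hx.1
    refine lt_of_pow_lt_pow_left₀ 2 (mul_nonneg (by linarith) (norm_nonneg _)) ?_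
    rw [sq_abs, mul_pow]
    have h2 : ‖x‖ ^ 2 < 2 := by nlinarith
    nlinarith [sq_nonneg ‖x‖, mul_pos hρ2 hρ2]
  calc μHE[d] (radial '' X)
      ≤ μHE[d] (radial '' (X ∩ Metric.ball 0 R)) + μHE[d] (radial '' (X \ Metric.ball 0 R)) := by
        conv_lhs => rw [← inter_union_sdiff X (Metric.ball 0 R), image_union]
        exact measure_union_le _ _
    _ ≤ _ := add_le_add hnear hfar'
    _ = _ := by rw [← mul_add, measure_inter_add_sdiff X Metric.isOpen_ball.measurableSet]

/-- The loss in area from a piece of a facet outside the ball to its radial projection. -/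
theorem euclideanHausdorffMeasure_radial_image_add_le (hd0 : d ≠ 0) {u : V} (hu : ‖u‖ = 1)
    {h ρ : ℝ} (hρ : 0 < ρ) (hρ1 : ρ ≤ 1) {D : Set V} (hD : ∀ x ∈ D, ⟪u, x⟫ = h ∧ 1 ≤ ‖x‖) :
    μHE[d] (radial '' D) + ENNReal.ofReal (ρ ^ 2 / 8) * μHE[d] (D ∩ farFromFoot h ρ) ≤
      μHE[d] D := by
  have hρ3 : ρ ^ 2 ≤ 1 := pow_le_one₀ hρ.le hρ1
  have hfar := euclideanHausdorffMeasure_radial_image_le_of_far hd0 hu hρ hρ1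
    (X := D ∩ farFromFoot h ρ) (fun x hx ↦ hD x hx.1) inter_subset_right
  have hnear := euclideanHausdorffMeasure_radial_image_le (d := d) one_pos
    (X := D \ farFromFoot h ρ) fun x hx ↦ (hD x hx.1).2
  rw [inv_one, ENNReal.ofReal_one, one_pow, one_mul] at hnear
  have hunion : μHE[d] (radial '' D) ≤ μHE[d] (radial '' (D ∩ farFromFoot h ρ)) +
      μHE[d] (radial '' (D \ farFromFoot h ρ)) := by
    conv_lhs => rw [← inter_union_sdiff D (farFromFoot h ρ), image_union]
    exact measure_union_le _ _
  have hone : ENNReal.ofReal (1 - ρ ^ 2 / 8) + ENNReal.ofReal (ρ ^ 2 / 8) = 1 := by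
    rw [← ENNReal.ofReal_add (by linarith) (by positivity)]; simp
  calc _ ≤ ENNReal.ofReal (1 - ρ ^ 2 / 8) * μHE[d] (D ∩ farFromFoot h ρ) +
        μHE[d] (D \ farFromFoot h ρ) + ENNReal.ofReal (ρ ^ 2 / 8) * μHE[d] (D ∩ farFromFoot h ρ) := by
        gcongr
        exact hunion.trans (add_le_add hfar hnear)
    _ = (ENNReal.ofReal (1 - ρ ^ 2 / 8) + ENNReal.ofReal (ρ ^ 2 / 8)) *
        μHE[d] (D ∩ farFromFoot h ρ) + μHE[d] (D \ farFromFoot h ρ) := by ring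
    _ = _ := by
        rw [hone, one_mul,
          measure_inter_add_sdiff D (isClosed_farFromFoot h ρ).measurableSet]

end FacetPieces

/-! ### Summing over the facets -/

section Deviation

variable {V : Type*} [NormedAddCommGroup V] [InnerProductSpace ℝ V] [FiniteDimensional ℝ V]
  [MeasurableSpace V] [BorelSpace V] {d : ℕ} [hd : Fact (finrank ℝ V = d + 1)]
  {ι : Type*} [Fintype ι] {P : Set V} {u : ι → V} {h : ι → ℝ} {D : ι → Set V} {ρ : ℝ}

theorem frontier_inter_ball_add_le (hu : ∀ i, ‖u i‖ = 1) (hle : ∀ i, ∀ y ∈ P, ⟪u i, y⟫ ≤ h i)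
    (hD : ∀ i, D i ⊆ P ∩ {x | ⟪u i, x⟫ = h i}) (hDm : ∀ i, MeasurableSet (D i))
    (hDd : Pairwise (Function.onFun Disjoint D)) (hcov : μHE[d] (frontier P \ ⋃ i, D i) = 0)
    (hρ : 0 < ρ) (hρ1 : ρ ≤ 1) :
    μHE[d] (frontier P ∩ Metric.ball 0 1) + ENNReal.ofReal (ρ ^ 2 / 8) *
        ∑ i, μHE[d] (D i ∩ Metric.ball 0 1 ∩ farFromFoot (h i) ρ) ≤
      μHE[d] (Metric.sphere 0 1 \ P) := by
  have hm : ∀ i, MeasurableSet (D i ∩ Metric.ball 0 1) := fun i ↦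
    (hDm i).inter Metric.isOpen_ball.measurableSet
  have hsub : ∀ i, D i ∩ Metric.ball 0 1 ⊆ P := fun i x hx ↦ (hD i hx.1).1
  have hfr : μHE[d] (frontier P ∩ Metric.ball 0 1) ≤ ∑ i, μHE[d] (D i ∩ Metric.ball 0 1) := by
    calc μHE[d] (frontier P ∩ Metric.ball 0 1)
        ≤ μHE[d] ((frontier P \ ⋃ i, D i) ∪ ⋃ i, D i ∩ Metric.ball 0 1) := by
          refine measure_mono fun x hx ↦ ?_
          by_cases hxD : x ∈ ⋃ i, D i
          · obtain ⟨i, hi⟩ := mem_iUnion.1 hxD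
            exact Or.inr (mem_iUnion.2 ⟨i, hi, hx.2⟩)
          · exact Or.inl ⟨hx.1, hxD⟩
      _ ≤ μHE[d] (frontier P \ ⋃ i, D i) + μHE[d] (⋃ i, D i ∩ Metric.ball 0 1) :=
          measure_union_le _ _
      _ ≤ _ := by
          rw [hcov, zero_add]
          exact measure_iUnion_fintype_le _ _
  calc _ ≤ ∑ i, μHE[d] (D i ∩ Metric.ball 0 1) + ENNReal.ofReal (ρ ^ 2 / 8) *
        ∑ i, μHE[d] (D i ∩ Metric.ball 0 1 ∩ farFromFoot (h i) ρ) := by gcongr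
    _ = ∑ i, (μHE[d] (D i ∩ Metric.ball 0 1) + ENNReal.ofReal (ρ ^ 2 / 8) *
        μHE[d] (D i ∩ Metric.ball 0 1 ∩ farFromFoot (h i) ρ)) := by
        rw [Finset.mul_sum, Finset.sum_add_distrib]
    _ ≤ ∑ i, μHE[d] (sphereAbove (u i) (h i) (D i ∩ Metric.ball 0 1)) :=
        Finset.sum_le_sum fun i _ ↦ euclideanHausdorffMeasure_add_le_sphereAbove (hu i) hρ hρ1
          (hm i) fun x hx ↦ ⟨(hD i hx.1).2, by simpa using hx.2⟩
    _ = μHE[d] (⋃ i, sphereAbove (u i) (h i) (D i ∩ Metric.ball 0 1)) := by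
        rw [measure_iUnion _ fun i ↦ measurableSet_sphereAbove _ _ (hm i), tsum_fintype]
        exact fun i j hij ↦ disjoint_sphereAbove (hu i) (hu j) (hle i) (hle j) (hsub i) (hsub j)
          ((hDd hij).mono inter_subset_left inter_subset_left)
    _ ≤ _ := measure_mono (iUnion_subset fun i ↦ sphereAbove_subset_sdiff (hle i) _)

/-- The radial images need only cover the sphere inside `P`, so their overlaps are harmless;
disjointness is used for the pieces `D i` themselves. -/
theorem sphere_inter_add_le (hd0 : d ≠ 0) (hP : IsCompact P) (hu : ∀ i, ‖u i‖ = 1)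
    (hle : ∀ i, ∀ y ∈ P, ⟪u i, y⟫ ≤ h i) (hD : ∀ i, D i ⊆ P ∩ {x | ⟪u i, x⟫ = h i})
    (hDm : ∀ i, MeasurableSet (D i)) (hDd : Pairwise (Function.onFun Disjoint D))
    (hcov : μHE[d] (frontier P \ ⋃ i, D i) = 0) (hρ : 0 < ρ) (hρ1 : ρ ≤ 1) :
    μHE[d] (Metric.sphere 0 1 ∩ P) + ENNReal.ofReal (ρ ^ 2 / 8) *
        ∑ i, μHE[d] ((D i \ Metric.ball 0 1) ∩ farFromFoot (h i) ρ) ≤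
      μHE[d] (frontier P \ Metric.ball 0 1) := by
  have hm : ∀ i, MeasurableSet (D i \ Metric.ball 0 1) := fun i ↦
    (hDm i).diff Metric.isOpen_ball.measurableSet
  have hnull : μHE[d] (radial '' ((frontier P \ ⋃ i, D i) \ Metric.ball 0 1)) = 0 := by
    have := euclideanHausdorffMeasure_radial_image_le (d := d) one_pos
      (X := (frontier P \ ⋃ i, D i) \ Metric.ball 0 1) fun x hx ↦ by simpa using hx.2
    rw [measure_mono_null sdiff_subset hcov, mul_zero] at this
    exact le_antisymm this zero_le
  have hfr : μHE[d] (Metric.sphere 0 1 ∩ P) ≤ ∑ i, μHE[d] (radial '' (D i \ Metric.ball 0 1)) := by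
    calc μHE[d] (Metric.sphere 0 1 ∩ P)
        ≤ μHE[d] (radial '' ((frontier P \ ⋃ i, D i) \ Metric.ball 0 1) ∪
            ⋃ i, radial '' (D i \ Metric.ball 0 1)) := by
          refine measure_mono ((sphere_inter_subset_radial_image hP).trans ?_)
          rw [← image_iUnion, ← image_union]
          refine image_mono fun x hx ↦ ?_
          by_cases hxD : x ∈ ⋃ i, D i
          · obtain ⟨i, hi⟩ := mem_iUnion.1 hxD
            exact Or.inr (mem_iUnion.2 ⟨i, hi, hx.2⟩)
          · exact Or.inl ⟨⟨hx.1, hxD⟩, hx.2⟩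
      _ ≤ _ := measure_union_le _ _
      _ ≤ _ := by
          rw [hnull, zero_add]
          exact measure_iUnion_fintype_le _ _
  calc _ ≤ ∑ i, μHE[d] (radial '' (D i \ Metric.ball 0 1)) + ENNReal.ofReal (ρ ^ 2 / 8) *
        ∑ i, μHE[d] ((D i \ Metric.ball 0 1) ∩ farFromFoot (h i) ρ) := by gcongr
    _ = ∑ i, (μHE[d] (radial '' (D i \ Metric.ball 0 1)) + ENNReal.ofReal (ρ ^ 2 / 8) *
        μHE[d] ((D i \ Metric.ball 0 1) ∩ farFromFoot (h i) ρ)) := by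
        rw [Finset.mul_sum, Finset.sum_add_distrib]
    _ ≤ ∑ i, μHE[d] (D i \ Metric.ball 0 1) :=
        Finset.sum_le_sum fun i _ ↦ euclideanHausdorffMeasure_radial_image_add_le hd0 (hu i) hρ hρ1
          fun x hx ↦ ⟨(hD i hx.1).2, by simpa using hx.2⟩
    _ = μHE[d] (⋃ i, D i \ Metric.ball 0 1) := by
        rw [measure_iUnion _ hm, tsum_fintype]
        exact fun i j hij ↦ (hDd hij).mono sdiff_subset sdiff_subset
    _ ≤ _ := measure_mono (iUnion_subset fun i ↦ sdiff_subset_sdiff_left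
        ((hD i).trans (inter_hyperplane_subset_frontier (hu i) (hle i))))

omit [FiniteDimensional ℝ V] hd in
theorem frontier_le_far_add (hu : ∀ i, ‖u i‖ = 1) (hD : ∀ i, D i ⊆ P ∩ {x | ⟪u i, x⟫ = h i})
    (hcov : μHE[d] (frontier P \ ⋃ i, D i) = 0) (hρ : 0 < ρ) :
    μHE[d] (frontier P) ≤ ∑ i, μHE[d] (D i ∩ Metric.ball 0 1 ∩ farFromFoot (h i) ρ) +
      ∑ i, μHE[d] ((D i \ Metric.ball 0 1) ∩ farFromFoot (h i) ρ) +
      Fintype.card ι * (ENNReal.ofReal ρ ^ d * μHE[d] (Metric.sphere (0 : V) 1)) := by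
  have hi : ∀ i, μHE[d] (D i) ≤ μHE[d] (D i ∩ Metric.ball 0 1 ∩ farFromFoot (h i) ρ) +
      μHE[d] ((D i \ Metric.ball 0 1) ∩ farFromFoot (h i) ρ) +
      ENNReal.ofReal ρ ^ d * μHE[d] (Metric.sphere (0 : V) 1) := fun i ↦ by
    refine (measure_mono (t := (D i ∩ Metric.ball 0 1 ∩ farFromFoot (h i) ρ) ∪
      ((D i \ Metric.ball 0 1) ∩ farFromFoot (h i) ρ) ∪
      {x | ⟪u i, x⟫ = h i ∧ ‖x‖ ^ 2 - h i ^ 2 < ρ ^ 2}) fun x hx ↦ ?_).trans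
      ((measure_union_le _ _).trans (add_le_add (measure_union_le _ _)
        (euclideanHausdorffMeasure_disc_le (hu i) (h i) hρ)))
    by_cases hf : x ∈ farFromFoot (h i) ρ
    · by_cases hb : x ∈ Metric.ball 0 1
      · exact Or.inl (Or.inl ⟨⟨hx, hb⟩, hf⟩)
      · exact Or.inl (Or.inr ⟨⟨hx, hb⟩, hf⟩)
    · exact Or.inr ⟨(hD i hx).2, not_le.1 hf⟩
  calc μHE[d] (frontier P) ≤ μHE[d] ((frontier P \ ⋃ i, D i) ∪ ⋃ i, D i) :=
        measure_mono (by rw [sdiff_union_self]; exact subset_union_left)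
    _ ≤ μHE[d] (frontier P \ ⋃ i, D i) + μHE[d] (⋃ i, D i) := measure_union_le _ _
    _ ≤ ∑ i, μHE[d] (D i) := by rw [hcov, zero_add]; exact measure_iUnion_fintype_le _ _
    _ ≤ _ := Finset.sum_le_sum fun i _ ↦ hi i
    _ = _ := by simp [Finset.sum_add_distrib, Finset.card_univ]

/-- Finiteness matters because `surfaceArea` is a real-valued measure, which would be 0 on infinite
area. -/
theorem frontier_lt_top (hP : IsCompact P) (hu : ∀ i, ‖u i‖ = 1)
    (hD : ∀ i, D i ⊆ P ∩ {x | ⟪u i, x⟫ = h i})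
    (hcov : μHE[d] (frontier P \ ⋃ i, D i) = 0) : μHE[d] (frontier P) < ∞ := by
  obtain ⟨R, hR0, hR⟩ := hP.isBounded.exists_pos_norm_le
  have hlt : ∀ i, μHE[d] (D i) < ∞ := fun i ↦ by
    refine ((measure_mono fun x hx ↦ ?_).trans
      (euclideanHausdorffMeasure_disc_le (hu i) (h i) (ρ := R + 1) (by linarith))).trans_lt
      (ENNReal.mul_lt_top (by simp) euclideanHausdorffMeasure_sphere_lt_top)
    have hxR := hR x (hD i hx).1
    exact ⟨(hD i hx).2, by nlinarith [norm_nonneg x, sq_nonneg (h i)]⟩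
  calc μHE[d] (frontier P) ≤ μHE[d] ((frontier P \ ⋃ i, D i) ∪ ⋃ i, D i) :=
        measure_mono (by rw [sdiff_union_self]; exact subset_union_left)
    _ ≤ μHE[d] (frontier P \ ⋃ i, D i) + μHE[d] (⋃ i, D i) := measure_union_le _ _
    _ ≤ ∑ i, μHE[d] (D i) := by rw [hcov, zero_add]; exact measure_iUnion_fintype_le _ _
    _ < ∞ := ENNReal.sum_lt_top.2 fun i _ ↦ hlt i

/-- This lets boundary points on the sphere be counted as lying outside the ball. -/
theorem frontier_inter_sphere_eq_zero (hd0 : d ≠ 0) (hu : ∀ i, ‖u i‖ = 1)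
    (hD : ∀ i, D i ⊆ P ∩ {x | ⟪u i, x⟫ = h i})
    (hcov : μHE[d] (frontier P \ ⋃ i, D i) = 0) :
    μHE[d] (frontier P ∩ Metric.sphere 0 1) = 0 := by
  refine measure_mono_null (t := (frontier P \ ⋃ i, D i) ∪
    ⋃ i, {x | ‖x‖ = 1 ∧ ⟪u i, x⟫ = h i}) (fun x hx ↦ ?_) (measure_union_null hcov
    (measure_iUnion_null fun i ↦ euclideanHausdorffMeasure_sphere_inter_hyperplane hd0 (hu i) _))
  by_cases hxD : x ∈ ⋃ i, D i
  · obtain ⟨i, hi⟩ := mem_iUnion.1 hxD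
    exact Or.inr (mem_iUnion.2 ⟨i, by simpa using hx.2, (hD i hi).2⟩)
  · exact Or.inl ⟨hx.1, hxD⟩

end Deviation

/-! ### Boundaries of the union and the intersection -/

section UnionInter

variable {d : ℕ} {P : Set (EuclideanSpace ℝ (Fin (d + 1)))}

theorem frontier_unitBall (n : ℕ) : frontier (unitBall n) = Metric.sphere 0 1 :=
  frontier_closedBall _ one_ne_zero

theorem sdiff_union_sdiff_subset_frontier_union {X : Type*} [TopologicalSpace X] {K L : Set X}
    (hK : IsClosed K) (hL : IsClosed L) :
    (frontier K \ L) ∪ (frontier L \ K) ⊆ frontier (K ∪ L) := by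
  have key : ∀ {K L : Set X}, IsClosed L → frontier K \ L ⊆ frontier (K ∪ L) := by
    rintro K L hL x ⟨⟨hxc, hxi⟩, hxL⟩
    refine ⟨closure_mono subset_union_left hxc, fun hint ↦ hxi ?_⟩
    rw [mem_interior_iff_mem_nhds] at hint ⊢
    filter_upwards [hint, hL.isOpen_compl.mem_nhds hxL] with y hy hyL
    exact hy.resolve_right hyL
  refine union_subset (key hL) ?_
  rw [union_comm K L]
  exact key hK

/-- The deviation is bounded below by comparing the four pieces of the two boundaries. -/
theorem le_surfaceDeviation (hPc : IsClosed P) (hfin : μHE[d] (frontier P) < ∞)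
    (hnull : μHE[d] (frontier P ∩ Metric.sphere 0 1) = 0) :
    (μHE[d] : Measure _).real (Metric.sphere 0 1 \ P) +
        (μHE[d] : Measure _).real (frontier P \ Metric.ball 0 1) -
      ((μHE[d] : Measure _).real (Metric.sphere 0 1 ∩ P) +
        (μHE[d] : Measure _).real (frontier P ∩ Metric.ball 0 1)) ≤
      surfaceDeviation (unitBall (d + 1)) P := by
  have : Fact (finrank ℝ (EuclideanSpace ℝ (Fin (d + 1))) = d + 1) := ⟨by simp⟩
  have hS : μHE[d] (Metric.sphere (0 : EuclideanSpace ℝ (Fin (d + 1))) 1) ≠ ∞ :=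
    euclideanHausdorffMeasure_sphere_lt_top.ne
  have hBc : IsClosed (unitBall (d + 1)) := Metric.isClosed_closedBall
  have hunion : μHE[d] (Metric.sphere 0 1 \ P) + μHE[d] (frontier P \ Metric.ball 0 1) ≤
      μHE[d] (frontier (unitBall (d + 1) ∪ P)) := by
    have h1 : μHE[d] (frontier P \ Metric.ball 0 1) ≤ μHE[d] (frontier P \ unitBall (d + 1)) := by
      refine (measure_mono (t := (frontier P ∩ Metric.sphere 0 1) ∪
        (frontier P \ unitBall (d + 1))) fun x hx ↦ ?_).trans ((measure_union_le _ _).trans ?_)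
      · by_cases hxB : x ∈ unitBall (d + 1)
        · have : x ∈ Metric.closedBall 0 1 \ Metric.ball 0 1 := ⟨hxB, hx.2⟩
          rw [Metric.closedBall_sdiff_ball] at this
          exact Or.inl ⟨hx.1, this⟩
        · exact Or.inr ⟨hx.1, hxB⟩
      · rw [hnull, zero_add]
    have h2 := sdiff_union_sdiff_subset_frontier_union hBc hPc
    rw [frontier_unitBall] at h2
    refine le_trans ?_ (measure_mono h2)
    rw [measure_union _ (isClosed_frontier.measurableSet.diff hBc.measurableSet)]
    · gcongr
    · exact Set.disjoint_left.2 fun x hx hx' ↦ hx.2 (hPc.frontier_subset hx'.1)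
  have hinter : μHE[d] (frontier (unitBall (d + 1) ∩ P)) ≤
      μHE[d] (Metric.sphere 0 1 ∩ P) + μHE[d] (frontier P ∩ Metric.ball 0 1) := by
    have h1 := frontier_inter_subset (unitBall (d + 1)) P
    rw [frontier_unitBall, hPc.closure_eq, hBc.closure_eq] at h1
    refine (measure_mono (t := (Metric.sphere 0 1 ∩ P) ∪ (frontier P ∩ Metric.ball 0 1)) ?_).trans
      (measure_union_le _ _)
    refine h1.trans (union_subset subset_union_left fun x hx ↦ ?_)
    by_cases hxb : x ∈ Metric.ball 0 1
    · exact Or.inr ⟨hx.2, hxb⟩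
    · have : x ∈ Metric.closedBall 0 1 \ Metric.ball 0 1 := ⟨hx.1, hxb⟩
      rw [Metric.closedBall_sdiff_ball] at this
      exact Or.inl ⟨this, hPc.frontier_subset hx.2⟩
  have hfinU : μHE[d] (frontier (unitBall (d + 1) ∪ P)) ≠ ∞ := by
    have h1 := frontier_union_subset (unitBall (d + 1)) P
    rw [frontier_unitBall] at h1
    refine ((measure_mono (h1.trans (union_subset_union inter_subset_left
      inter_subset_right))).trans (measure_union_le _ _)).trans_lt ?_ |>.ne
    exact ENNReal.add_lt_top.2 ⟨hS.lt_top, hfin⟩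
  have ha : μHE[d] (Metric.sphere 0 1 \ P) ≠ ∞ := measure_ne_top_of_subset sdiff_subset hS
  have hb : μHE[d] (Metric.sphere 0 1 ∩ P) ≠ ∞ := measure_ne_top_of_subset inter_subset_left hS
  have hqi : μHE[d] (frontier P ∩ Metric.ball 0 1) ≠ ∞ :=
    measure_ne_top_of_subset inter_subset_left hfin.ne
  have hqo : μHE[d] (frontier P \ Metric.ball 0 1) ≠ ∞ :=
    measure_ne_top_of_subset sdiff_subset hfin.ne
  unfold surfaceDeviation surfaceArea Measure.real
  rw [Nat.add_sub_cancel, ← ENNReal.toReal_add ha hqo, ← ENNReal.toReal_add hb hqi]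
  exact sub_le_sub (ENNReal.toReal_mono hfinU hunion)
    (ENNReal.toReal_mono (ENNReal.add_ne_top.2 ⟨hb, hqi⟩) hinter)

end UnionInter

/-! ### Combining the estimates and choosing the threshold -/

/-- Lower bounds for the deviation in terms of a threshold distance `ρ`. -/
theorem surfaceDeviation_bounds {d M : ℕ} (hd0 : d ≠ 0)
    {P : Set (EuclideanSpace ℝ (Fin (d + 1)))} (hP : IsPolytope P)
    (hM : {F | IsFacet P F}.encard ≤ M) {ρ : ℝ} (hρ : 0 < ρ) (hρ1 : ρ ≤ 1) :
    ρ ^ 2 / 8 * (surfaceArea P - M * ρ ^ d * surfaceArea (unitBall (d + 1))) ≤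
        surfaceDeviation (unitBall (d + 1)) P ∧
      surfaceArea (unitBall (d + 1)) - surfaceArea P ≤
        surfaceDeviation (unitBall (d + 1)) P := by
  have : Fact (finrank ℝ (EuclideanSpace ℝ (Fin (d + 1))) = d + 1) := ⟨by simp⟩
  have hPk : IsCompact P := by
    obtain ⟨s, hs, rfl⟩ := hP
    exact hs.isCompact_convexHull (𝕜 := ℝ)
  obtain ⟨m, u, h, hmM, hu, hle, hcov⟩ := hP.exists_facet_normals hM
  set F : Fin m → Set (EuclideanSpace ℝ (Fin (d + 1))) := fun i ↦ P ∩ {x | ⟪u i, x⟫ = h i} with hF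
  have hFm : ∀ i, MeasurableSet (F i) := fun i ↦
    (hPk.isClosed.inter (isClosed_eq (by fun_prop) (by fun_prop))).measurableSet
  -- Distinct facets may share lower-dimensional faces; disjointing them avoids double counting.
  have hD : ∀ i, disjointed F i ⊆ P ∩ {x | ⟪u i, x⟫ = h i} := disjointed_subset F
  have hDm : ∀ i, MeasurableSet (disjointed F i) := fun i ↦
    disjointedRec (fun {t} j ht ↦ ht.diff (hFm j)) (hFm i)
  have hDd := disjoint_disjointed F
  rw [← iUnion_disjointed] at hcov
  have hS : μHE[d] (Metric.sphere (0 : EuclideanSpace ℝ (Fin (d + 1))) 1) ≠ ∞ :=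
    euclideanHausdorffMeasure_sphere_lt_top.ne
  have hfin : μHE[d] (frontier P) < ∞ := frontier_lt_top hPk hu hD hcov
  have hdev := le_surfaceDeviation hPk.isClosed hfin
    (frontier_inter_sphere_eq_zero hd0 hu hD hcov)
  have hin := frontier_inter_ball_add_le hu hle hD hDm hDd hcov hρ hρ1
  have hout := sphere_inter_add_le hd0 hPk hu hle hD hDm hDd hcov hρ hρ1
  have htot := frontier_le_far_add hu hD hcov hρ
  set Ti := ∑ i, μHE[d] (disjointed F i ∩ Metric.ball 0 1 ∩ farFromFoot (h i) ρ) with hTi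
  set To := ∑ i, μHE[d] ((disjointed F i \ Metric.ball 0 1) ∩ farFromFoot (h i) ρ) with hTo
  have hDfin : ∀ i, μHE[d] (disjointed F i) ≠ ∞ := fun i ↦ measure_ne_top_of_subset
    ((hD i).trans (inter_hyperplane_subset_frontier (hu i) (hle i))) hfin.ne
  have hTi' : Ti ≠ ∞ := ENNReal.sum_ne_top.2 fun i _ ↦
    measure_ne_top_of_subset (inter_subset_left.trans inter_subset_left) (hDfin i)
  have hTo' : To ≠ ∞ := ENNReal.sum_ne_top.2 fun i _ ↦
    measure_ne_top_of_subset (inter_subset_left.trans sdiff_subset) (hDfin i)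
  have ha : μHE[d] (Metric.sphere 0 1 \ P) ≠ ∞ := measure_ne_top_of_subset sdiff_subset hS
  have hb : μHE[d] (Metric.sphere 0 1 ∩ P) ≠ ∞ := measure_ne_top_of_subset inter_subset_left hS
  have hqi : μHE[d] (frontier P ∩ Metric.ball 0 1) ≠ ∞ :=
    measure_ne_top_of_subset inter_subset_left hfin.ne
  have hqo : μHE[d] (frontier P \ Metric.ball 0 1) ≠ ∞ :=
    measure_ne_top_of_subset sdiff_subset hfin.ne
  have hSsum := measureReal_inter_add_sdiff (μ := (μHE[d] : Measure _))
    (s := Metric.sphere (0 : EuclideanSpace ℝ (Fin (d + 1))) 1) hPk.isClosed.measurableSet hS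
  have hPsum := measureReal_inter_add_sdiff (μ := (μHE[d] : Measure _))
    (s := frontier P) (Metric.isOpen_ball (x := 0) (ε := 1)).measurableSet hfin.ne
  have hSA : surfaceArea (unitBall (d + 1)) =
      (μHE[d] : Measure _).real (Metric.sphere (0 : EuclideanSpace ℝ (Fin (d + 1))) 1) := by
    rw [surfaceArea, frontier_unitBall, Nat.add_sub_cancel]
  have hPA : surfaceArea P = (μHE[d] : Measure _).real (frontier P) := rfl
  have ht : 0 ≤ ρ ^ 2 / 8 := by positivity
  replace hin := ENNReal.toReal_mono ha hin
  replace hout := ENNReal.toReal_mono hqo hout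
  rw [ENNReal.toReal_add hqi (ENNReal.mul_ne_top ENNReal.ofReal_ne_top hTi'), ENNReal.toReal_mul,
    ENNReal.toReal_ofReal ht] at hin
  rw [ENNReal.toReal_add hb (ENNReal.mul_ne_top ENNReal.ofReal_ne_top hTo'), ENNReal.toReal_mul,
    ENNReal.toReal_ofReal ht] at hout
  have hnear : (Fintype.card (Fin m) : ℝ≥0∞) * (ENNReal.ofReal ρ ^ d *
      μHE[d] (Metric.sphere (0 : EuclideanSpace ℝ (Fin (d + 1))) 1)) ≠ ∞ :=
    ENNReal.mul_ne_top (by simp) (ENNReal.mul_ne_top (by simp) hS)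
  replace htot := ENNReal.toReal_mono
    (ENNReal.add_ne_top.2 ⟨ENNReal.add_ne_top.2 ⟨hTi', hTo'⟩, hnear⟩) htot
  rw [ENNReal.toReal_add (ENNReal.add_ne_top.2 ⟨hTi', hTo'⟩) hnear, ENNReal.toReal_add hTi' hTo',
    ENNReal.toReal_mul, ENNReal.toReal_mul, ENNReal.toReal_pow, ENNReal.toReal_ofReal hρ.le,
    ENNReal.toReal_natCast, Fintype.card_fin] at htot
  simp only [Measure.real] at hdev hSsum hPsum hSA hPA
  have hmul : (m : ℝ) * (ρ ^ d * (μHE[d]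
      (Metric.sphere (0 : EuclideanSpace ℝ (Fin (d + 1))) 1)).toReal) ≤
      M * ρ ^ d * surfaceArea (unitBall (d + 1)) := by
    rw [hSA, mul_assoc]
    gcongr
  have hTi0 : 0 ≤ ρ ^ 2 / 8 * Ti.toReal := by positivity
  have hTo0 : 0 ≤ ρ ^ 2 / 8 * To.toReal := by positivity
  -- Second bound: with a = |S \ P| - |∂P ∩ B| ≥ 0 and b = |∂P \ B| - |S ∩ P| ≥ 0, the deviation is
  -- at least a + b ≥ a - b = |S| - |∂P|.
  refine ⟨?_, by linarith⟩
  have hfar : surfaceArea P - M * ρ ^ d * surfaceArea (unitBall (d + 1)) ≤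
      Ti.toReal + To.toReal := by linarith
  have := mul_le_mul_of_nonneg_left hfar ht
  linarith

theorem theorem2 :
    ∃ c : ℝ, 0 < c ∧ ∃ M₀ : ℕ, ∀ n : ℕ, 2 ≤ n → ∀ M : ℕ, M₀ ≤ M →
      ∀ P : Set (EuclideanSpace ℝ (Fin n)), IsPolytope P →
        {F : Set (EuclideanSpace ℝ (Fin n)) | IsFacet P F}.encard ≤ M →
          c * (surfaceArea (unitBall n) / (M : ℝ) ^ ((2 : ℝ) / ((n : ℝ) - 1))) ≤
            surfaceDeviation (unitBall n) P := by
  -- 1/512 = 1/32 · 1/16: the gain ρ²/32 together with M^(-2/d) ≤ 16 ρ².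
  refine ⟨1 / 512, by norm_num, 1, fun n hn M hM P hP hfac ↦ ?_⟩
  obtain ⟨d, rfl⟩ : ∃ d, n = d + 1 := ⟨n - 1, by omega⟩
  have hd0 : d ≠ 0 := by omega
  have hd1 : (1 : ℝ) ≤ d := by exact_mod_cast Nat.one_le_iff_ne_zero.2 hd0
  have hM1 : (1 : ℝ) ≤ M := by exact_mod_cast hM
  have h4M : (0 : ℝ) < 4 * M := by linarith
  -- Chosen so that M ρ^d = 1/4: the discs around the feet take up at most a quarter of the sphere's
  -- area.
  set ρ : ℝ := (4 * M : ℝ) ^ (-(1 / d) : ℝ) with hρdef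
  have hρ : 0 < ρ := Real.rpow_pos_of_pos h4M _
  have hρ1 : ρ ≤ 1 :=
    Real.rpow_le_one_of_one_le_of_nonpos (by linarith) (neg_nonpos.2 (by positivity))
  have hρd : M * ρ ^ d = 1 / 4 := by
    rw [hρdef, ← Real.rpow_natCast, ← Real.rpow_mul h4M.le,
      show -(1 / (d : ℝ)) * d = -1 by field_simp, Real.rpow_neg_one]
    field_simp
  set S := surfaceArea (unitBall (d + 1)) with hS
  have hS0 : 0 ≤ S := ENNReal.toReal_nonneg
  have hρ2 : 1 / (M : ℝ) ^ ((2 : ℝ) / (((d + 1 : ℕ) : ℝ) - 1)) ≤ 16 * ρ ^ 2 := by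
    have he : (((d + 1 : ℕ) : ℝ) - 1) = d := by push_cast; ring
    have hsq : ρ ^ 2 = ((4 : ℝ) ^ (2 / d : ℝ))⁻¹ * ((M : ℝ) ^ (2 / d : ℝ))⁻¹ := by
      rw [hρdef, ← Real.rpow_natCast, ← Real.rpow_mul h4M.le,
        show -(1 / (d : ℝ)) * (2 : ℕ) = -(2 / d) by push_cast; ring, Real.rpow_neg h4M.le,
        Real.mul_rpow (by norm_num) (by linarith), mul_inv]
    have h16 : (4 : ℝ) ^ (2 / d : ℝ) ≤ 16 := by
      calc (4 : ℝ) ^ (2 / d : ℝ) ≤ (4 : ℝ) ^ (2 : ℝ) :=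
            Real.rpow_le_rpow_of_exponent_le (by norm_num) (div_le_self (by norm_num) hd1)
        _ = 16 := by norm_num
    have hM0 : 0 < ((M : ℝ) ^ (2 / d : ℝ))⁻¹ := inv_pos.2 (Real.rpow_pos_of_pos (by linarith) _)
    have h40 : (0 : ℝ) < (4 : ℝ) ^ (2 / d : ℝ) := Real.rpow_pos_of_pos (by norm_num) _
    rw [he, hsq, one_div, ← mul_assoc]
    refine le_mul_of_one_le_left hM0.le ?_
    rw [← div_eq_mul_inv, one_le_div h40]
    exact h16
  have hgoal : 1 / 512 * (S / (M : ℝ) ^ ((2 : ℝ) / (((d + 1 : ℕ) : ℝ) - 1))) ≤ ρ ^ 2 / 32 * S := by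
    have := mul_le_mul_of_nonneg_left hρ2 hS0
    rw [mul_one_div] at this
    linarith
  refine hgoal.trans ?_
  obtain ⟨hfar, hsmall⟩ := surfaceDeviation_bounds hd0 hP hfac hρ hρ1
  rw [hρd] at hfar
  have hρ3 : ρ ^ 2 ≤ 1 := pow_le_one₀ hρ.le hρ1
  rcases le_total (S / 2) (surfaceArea P) with hcase | hcase
  · refine le_trans ?_ hfar
    have : S / 4 ≤ surfaceArea P - 1 / 4 * S := by linarith
    have := mul_le_mul_of_nonneg_left this (by positivity : 0 ≤ ρ ^ 2 / 8)
    linarith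
  · refine le_trans ?_ hsmall
    nlinarith
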